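/- Let $d\ge 3$ and let $H_0=-\Delta$ be the free Hamiltonian in $L^2(\mathbb R^d)$ (complex-valued functions) with domain $W^{2,2}(\mathbb R^d)$. Then $\sigma(H_0)=[0,\infty)$, and for every $\lambda\in\mathbb C\setminus[0,\infty)$ the operator $|x|^{-1}(H_0-\lambda)^{-1}|x|^{-1}$, considered on its natural domain in $L^2(\mathbb R^d)$ (where $|x|^{-1}$ denotes the maximal operator of multiplication by the function $x\mapsto|x|^{-1}$), is densely defined and bounded. Moreover it is bounded uniformly in $\lambda$: $$ C:=\sup_{\lambda\notin\sigma(H_0)}\big\||x|^{-1}(H_0-\lambda)^{-1}|x|^{-1}\big\|<\infty , $$ and one has the explicit bound $C\le C_3(d)$ with $$ C_3(d):=\frac{6}{d-2}\left[\left(\frac{d-1}{d-2}\right)^2+\frac34\left(\frac{2}{d-2}\right)^{2/3}+1\right]^{1/2}. $$ -/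

import Mathlib

open MeasureTheory
open scoped ENNReal Laplacian SchwartzMap

noncomputable section

/-! ### Unbounded operators in a complex normed space -/

namespace UnboundedOperator

variable {H : Type*} [NormedAddCommGroup H] [NormedSpace ℂ H]

/-- The operator `A - z`, with the domain of `A`. -/
def shift (A : H →ₗ.[ℂ] H) (z : ℂ) : H →ₗ.[ℂ] H :=
  (-(z • (LinearMap.id : H →ₗ[ℂ] H))) +ᵥ A

/-- The resolvent set of `A`: those `z` for which `A - z` is a bijection of the domain of `A`
onto `H` with a bounded inverse. -/
def resolventSet (A : H →ₗ.[ℂ] H) : Set ℂ :=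
  {z | Function.Bijective (shift A z) ∧
    ∃ K : ℝ, ∀ ψ : (shift A z).domain, ‖(ψ : H)‖ ≤ K * ‖shift A z ψ‖}

/-- The spectrum of `A`. -/
def spectrum (A : H →ₗ.[ℂ] H) : Set ℂ := (resolventSet A)ᶜ

/-- The resolvent `(A - z)⁻¹`. -/
def resolvent (A : H →ₗ.[ℂ] H) (z : ℂ) : H →ₗ.[ℂ] H := (shift A z).inverse

/-- The product `B A` of two operators on its natural domain
`{ψ ∈ dom A : A ψ ∈ dom B}`. -/
def prod (B A : H →ₗ.[ℂ] H) : H →ₗ.[ℂ] H :=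
  B.comp (A.domRestrict ((B.domain.comap A.toFun).map A.domain.subtype)) (by
    rintro ⟨x, hx⟩
    obtain ⟨⟨y, hy, hyx⟩, -⟩ := Submodule.mem_inf.mp hx
    have h := LinearPMap.domRestrict_apply (f := A) (x := ⟨x, hx⟩) (y := y) hyx.symm
    exact h ▸ hy)

theorem mem_prod_domain (B A : H →ₗ.[ℂ] H) (ψ : H) :
    ψ ∈ (prod B A).domain ↔ ∃ h : ψ ∈ A.domain, A ⟨ψ, h⟩ ∈ B.domain := by
  change ψ ∈ ((B.domain.comap A.toFun).map A.domain.subtype) ⊓ A.domain ↔ _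
  constructor
  · rintro ⟨⟨y, hy, rfl⟩, -⟩
    exact ⟨y.2, hy⟩
  · rintro ⟨h, h2⟩
    exact ⟨⟨⟨ψ, h⟩, h2, rfl⟩, h⟩

/-- The operator norm `sup ‖A ψ‖ / ‖ψ‖` over the nonzero `ψ` in the domain of `A`, which may
be infinite (the quotient `0 / 0`, at `ψ = 0`, is `0` here). -/
def opENorm (A : H →ₗ.[ℂ] H) : ℝ≥0∞ :=
  ⨆ ψ : A.domain, ‖A ψ‖ₑ / ‖(ψ : H)‖ₑ

end UnboundedOperator

/-! ### The free Hamiltonian and the weight -/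

/-- The Hilbert space `L²(ℝᵈ)` of complex-valued functions. -/
abbrev L2Space (d : ℕ) : Type := Lp ℂ 2 (volume : Measure (EuclideanSpace ℝ (Fin d)))

/-- The Sobolev space `W^{2,2}(ℝᵈ)` as a subspace of `L²(ℝᵈ)`. -/
def sobolevTwo (d : ℕ) : Submodule ℂ (L2Space d) where
  carrier := {ψ | TemperedDistribution.MemSobolev 2 2
    (ψ : 𝓢'(EuclideanSpace ℝ (Fin d), ℂ))}
  zero_mem' := by
    have h := TemperedDistribution.memSobolev_fun_zero (EuclideanSpace ℝ (Fin d)) ℂ 2 2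
    rwa [← map_zero (Lp.toTemperedDistributionCLM ℂ
      (volume : Measure (EuclideanSpace ℝ (Fin d))) 2)] at h
  add_mem' := by
    intro ψ φ hψ hφ
    have h := TemperedDistribution.MemSobolev.add hψ hφ
    rw [← Lp.toTemperedDistributionCLM_apply, ← Lp.toTemperedDistributionCLM_apply,
      ← map_add] at h
    exact h
  smul_mem' := by
    intro c ψ hψ
    have h := TemperedDistribution.MemSobolev.smul c hψ
    rw [← Lp.toTemperedDistributionCLM_apply, ← map_smul] at h
    exact h

/-- Two elements of `L²` that agree as tempered distributions are equal. -/
theorem L2Space.ext_distribution {d : ℕ} {f g : L2Space d}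
    (h : (f : 𝓢'(EuclideanSpace ℝ (Fin d), ℂ)) = g) : f = g :=
  LinearMap.ker_eq_bot.mp (Lp.ker_toTemperedDistributionCLM_eq_bot
    (F := ℂ) (μ := (volume : Measure (EuclideanSpace ℝ (Fin d)))) (p := 2)) h

/-- The distributional Laplacian of a function in `W^{2,2}` is in `L²`. -/
theorem exists_neg_laplacian {d : ℕ} (ψ : sobolevTwo d) :
    ∃ g : L2Space d, (g : 𝓢'(EuclideanSpace ℝ (Fin d), ℂ)) =
      -Δ ((ψ : L2Space d) : 𝓢'(EuclideanSpace ℝ (Fin d), ℂ)) := by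
  have h := (TemperedDistribution.MemSobolev.laplacian (s := 2) ψ.2).neg
  rw [sub_self] at h
  obtain ⟨g, hg⟩ := TemperedDistribution.memSobolev_zero_iff.mp h
  exact ⟨g, hg.symm⟩

/-- The free Hamiltonian `H₀ = -Δ` in `L²(ℝᵈ)` with domain `W^{2,2}(ℝᵈ)`: `H₀ ψ` is the element
of `L²` that represents the distribution `-Δ ψ`. -/
def freeHamiltonian (d : ℕ) : L2Space d →ₗ.[ℂ] L2Space d where
  domain := sobolevTwo d
  toFun :=
    { toFun := fun ψ => (exists_neg_laplacian ψ).choose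
      map_add' := by
        intro ψ φ
        apply L2Space.ext_distribution
        rw [(exists_neg_laplacian (ψ + φ)).choose_spec, ← Lp.toTemperedDistributionCLM_apply,
          ← Lp.toTemperedDistributionCLM_apply, map_add, Submodule.coe_add, map_add,
          Lp.toTemperedDistributionCLM_apply, Lp.toTemperedDistributionCLM_apply,
          Lp.toTemperedDistributionCLM_apply, Lp.toTemperedDistributionCLM_apply,
          (exists_neg_laplacian ψ).choose_spec, (exists_neg_laplacian φ).choose_spec,
          ← TemperedDistribution.laplacianCLM_apply, map_add,
          TemperedDistribution.laplacianCLM_apply, TemperedDistribution.laplacianCLM_apply]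
        abel
      map_smul' := by
        intro c ψ
        apply L2Space.ext_distribution
        rw [(exists_neg_laplacian (c • ψ)).choose_spec, ← Lp.toTemperedDistributionCLM_apply,
          ← Lp.toTemperedDistributionCLM_apply, map_smul, Submodule.coe_smul, map_smul,
          Lp.toTemperedDistributionCLM_apply, Lp.toTemperedDistributionCLM_apply,
          (exists_neg_laplacian ψ).choose_spec,
          ← TemperedDistribution.laplacianCLM_apply, map_smul,
          TemperedDistribution.laplacianCLM_apply, RingHom.id_apply, smul_neg] }

theorem freeHamiltonian_apply {d : ℕ} (ψ : (freeHamiltonian d).domain) :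
    ((freeHamiltonian d ψ : L2Space d) : 𝓢'(EuclideanSpace ℝ (Fin d), ℂ)) =
      -Δ ((ψ : L2Space d) : 𝓢'(EuclideanSpace ℝ (Fin d), ℂ)) :=
  (exists_neg_laplacian ψ).choose_spec

/-- The domain `{ψ ∈ L² : |x|⁻¹ ψ ∈ L²}`. -/
def invNormDomain (d : ℕ) : Submodule ℂ (L2Space d) where
  carrier := {ψ | MemLp (fun x : EuclideanSpace ℝ (Fin d) => ‖x‖⁻¹ • ψ x) 2 volume}
  zero_mem' := by
    refine (MemLp.zero (ε := ℂ)).ae_eq ?_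
    filter_upwards [Lp.coeFn_zero ℂ 2 (volume : Measure (EuclideanSpace ℝ (Fin d)))] with x hx
    rw [hx]
    simp
  add_mem' := by
    intro ψ φ hψ hφ
    refine (MemLp.add hψ hφ).ae_eq ?_
    filter_upwards [Lp.coeFn_add ψ φ] with x hx
    simp only [hx, Pi.add_apply, smul_add]
  smul_mem' := by
    intro c ψ hψ
    refine (MemLp.const_smul hψ c).ae_eq ?_
    filter_upwards [Lp.coeFn_smul c ψ] with x hx
    simp only [hx, Pi.smul_apply, smul_comm c]

theorem invNormDomain_memLp {d : ℕ} (ψ : invNormDomain d) :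
    MemLp (fun x : EuclideanSpace ℝ (Fin d) => ‖x‖⁻¹ • (ψ : L2Space d) x) 2 volume := ψ.2

/-- The maximal operator of multiplication by `|x|⁻¹` in `L²(ℝᵈ)`. -/
def invNormMul (d : ℕ) : L2Space d →ₗ.[ℂ] L2Space d where
  domain := invNormDomain d
  toFun :=
    { toFun := fun ψ => (invNormDomain_memLp ψ).toLp
      map_add' := by
        intro ψ φ
        apply Lp.ext
        filter_upwards [(invNormDomain_memLp (ψ + φ)).coeFn_toLp,
          (invNormDomain_memLp ψ).coeFn_toLp, (invNormDomain_memLp φ).coeFn_toLp,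
          Lp.coeFn_add (invNormDomain_memLp ψ).toLp (invNormDomain_memLp φ).toLp,
          Lp.coeFn_add (ψ : L2Space d) (φ : L2Space d)] with x h1 h2 h3 h4 h5
        rw [h1, h4, Pi.add_apply, h2, h3, Submodule.coe_add, h5, Pi.add_apply, smul_add]
      map_smul' := by
        intro c ψ
        apply Lp.ext
        filter_upwards [(invNormDomain_memLp (c • ψ)).coeFn_toLp,
          (invNormDomain_memLp ψ).coeFn_toLp,
          Lp.coeFn_smul c (invNormDomain_memLp ψ).toLp,
          Lp.coeFn_smul c (ψ : L2Space d)] with x h1 h2 h3 h4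
        rw [h1, RingHom.id_apply, h3, Pi.smul_apply, h2, Submodule.coe_smul, h4, Pi.smul_apply,
          smul_comm] }

theorem invNormMul_apply {d : ℕ} (ψ : (invNormMul d).domain) :
    invNormMul d ψ =ᵐ[volume]
      fun x : EuclideanSpace ℝ (Fin d) => ‖x‖⁻¹ • (ψ : L2Space d) x :=
  (invNormDomain_memLp ψ).coeFn_toLp

/-- The weighted resolvent `|x|⁻¹ (H₀ - z)⁻¹ |x|⁻¹` on its natural domain. -/
def weightedResolvent (d : ℕ) (z : ℂ) : L2Space d →ₗ.[ℂ] L2Space d :=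
  UnboundedOperator.prod (invNormMul d)
    (UnboundedOperator.prod (UnboundedOperator.resolvent (freeHamiltonian d) z) (invNormMul d))

/-- The explicit constant `C₃(d)`. -/
def uniformConstant (d : ℕ) : ℝ :=
  6 / ((d : ℝ) - 2) *
    √((((d : ℝ) - 1) / ((d : ℝ) - 2)) ^ 2 + 3 / 4 * (2 / ((d : ℝ) - 2)) ^ (2 / 3 : ℝ) + 1)

end

noncomputable section

/-! On the Fourier side `-Δ - z` is multiplication by `4π²|ξ|² - z`. Off `[0, ∞)` the inverse symbol
is bounded and decays like `(1 + |ξ|²)⁻¹`, so it maps `L²` into `W^{2,2}`. On `[0, ∞)` the symbol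
has a zero, and bumps concentrated there rule out a bounded inverse. This gives the spectrum, but
with bounds that depend on `z`.

Uniformity comes from a multiplier argument. Write `z = k²` with `Im k ≥ 0`, `u = (H₀ - z)⁻¹ g` and
`r = |x|`. Factoring out the outgoing phase, `u = e^{ikr} v`, turns the gradient into the twisted
gradient `p = ∇u - ik (x/r) u`, and the equation becomes `g = -L - 2ik Q / r`, where `L` is the
trace of the twisted Hessian and `Q = x·p + (d-1)/2 u`. Pairing with `Q` yields a current `J`,
quadratic in `p` and `u`, such that `(d-2)²/16 · |u|²/r² ≤ r²|g|² - Re div J`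
(`multiplier_inequality`, `normSq_div_le_sub_div_current`). All contributions of `k` carry the
factor `Im k` and a favourable sign, hence the uniformity. Integrating against logarithmic cutoffs
removes the divergence (`integral_normSq_div_le`) and leaves `‖|x|⁻¹ u‖ ≤ 4/(d-2) ‖|x| g‖`, which is
stronger than the bound by `C₃(d)`.

The estimate is proved for Schwartz `g` and passes to every `g` with `|x| g ∈ L²` by a weighted
approximation and Fatou's lemma (`eLpNorm_resolvent_le`). -/

namespace UniformResolvent
open Complex ComplexConjugate Filter Topology FourierTransform TemperedDistribution LineDeriv

/-! ### Pointwise algebra of the multiplier identity -/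

/-- The sum over the coordinates of the derivatives of the two quadratic currents, in terms of
covariant derivatives. -/
theorem sum_current_deriv {d : ℕ} (x : Fin d → ℝ) (r : ℝ) (hr : 0 < r) (hx : ∑ i, x i ^ 2 = r ^ 2)
    (k c u : ℂ) (p : Fin d → ℂ) (M : Fin d → Fin d → ℂ) (hM : ∀ i j, M i j = M j i)
    (L S Q P T : ℂ) (hL : L = ∑ i, M i i) (hS : S = ∑ i, x i * p i)
    (hP : P = ∑ i, p i * conj (p i)) (hT : T = ∑ i, p i * conj (∑ j, x j * M i j)) (b : ℂ) :
    ∑ i, (-((M i i + I * k * (x i / r) * p i) * conj Q +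
        p i * conj ((1 + c) * p i + ∑ j, x j * M i j + I * k * (x i / r) * Q)) +
      1 / 2 * (P + x i * ∑ j, ((M i j + I * k * (x i / r) * p j) * conj (p j) +
        p j * conj (M i j + I * k * (x i / r) * p j))) +
      b * ((1 / r ^ 2 - 2 * x i ^ 2 / r ^ 4) * (u * conj u) + x i / r ^ 2 *
        ((p i + I * k * (x i / r) * u) * conj u + u * conj (p i + I * k * (x i / r) * u)))) =
    -(L * conj Q + I * k / r * S * conj Q + (1 + conj c) * P + T + conj (I * k) / r * conj Q * S) +
      1 / 2 * (d * P + (conj T + T) + (I * k + conj (I * k)) * r * P) +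
      b * ((d - 2) / r ^ 2 * (u * conj u) + (S * conj u + u * conj S) / r ^ 2 +
        (I * k + conj (I * k)) / r * (u * conj u)) := by
  have hr' : (r : ℂ) ≠ 0 := by exact_mod_cast hr.ne'
  have hx' : ∑ i, (x i : ℂ) ^ 2 = r ^ 2 := by exact_mod_cast congrArg ((↑) : ℝ → ℂ) hx
  have hS' : conj S = ∑ i, x i * conj (p i) := by simp [hS, map_sum]
  -- Symmetry of the Hessian lets the second-order terms coming from `1/2 x |p|²` be expressed by
  -- the same `T` that `-p conj Q` produces. In `-T + (T + conj T)/2` they then cancel up to an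
  -- imaginary quantity.
  have hT1 : ∑ i, x i * ∑ j, M i j * conj (p j) = conj T := by
    simp only [hT, map_sum, map_mul, conj_conj, Finset.mul_sum]
    rw [Finset.sum_comm]
    refine Finset.sum_congr rfl fun i _ => Finset.sum_congr rfl fun j _ => ?_
    rw [hM j i]; ring
  have hT2 : ∑ i, x i * ∑ j, p j * conj (M i j) = T := by
    simp only [hT, map_sum, map_mul, conj_ofReal, Finset.mul_sum]
    rw [Finset.sum_comm]
    refine Finset.sum_congr rfl fun i _ => Finset.sum_congr rfl fun j _ => ?_
    rw [hM j i]; ring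
  have key : ∀ i, (-((M i i + I * k * (x i / r) * p i) * conj Q +
        p i * conj ((1 + c) * p i + ∑ j, x j * M i j + I * k * (x i / r) * Q)) +
      1 / 2 * (P + x i * ∑ j, ((M i j + I * k * (x i / r) * p j) * conj (p j) +
        p j * conj (M i j + I * k * (x i / r) * p j))) +
      b * ((1 / r ^ 2 - 2 * x i ^ 2 / r ^ 4) * (u * conj u) + x i / r ^ 2 *
        ((p i + I * k * (x i / r) * u) * conj u + u * conj (p i + I * k * (x i / r) * u)))) =
      (-conj Q) * M i i + (-(I * k / r * conj Q + conj (I * k) / r * conj Q)) * (x i * p i) +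
      (-(1 + conj c)) * (p i * conj (p i)) + (-1) * (p i * conj (∑ j, x j * M i j)) +
      1 / 2 * P * 1 + 1 / 2 * (x i * ∑ j, M i j * conj (p j)) +
      1 / 2 * (x i * ∑ j, p j * conj (M i j)) +
      (1 / 2 * (I * k + conj (I * k)) / r * P) * (x i : ℂ) ^ 2 +
      b * (u * conj u) / r ^ 2 * 1 +
      (-2 * b * (u * conj u) / r ^ 4 + b * (I * k + conj (I * k)) / r ^ 3 * (u * conj u)) *
        (x i : ℂ) ^ 2 +
      b * conj u / r ^ 2 * (x i * p i) + b * u / r ^ 2 * (x i * conj (p i)) := by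
    intro i
    have h1 : ∑ j, ((M i j + I * k * (x i / r) * p j) * conj (p j) +
        p j * conj (M i j + I * k * (x i / r) * p j)) =
        ∑ j, M i j * conj (p j) + ∑ j, p j * conj (M i j) +
          (I * k + conj (I * k)) * (x i / r) * P := by
      rw [hP, Finset.mul_sum, ← Finset.sum_add_distrib, ← Finset.sum_add_distrib]
      refine Finset.sum_congr rfl fun j _ => ?_
      simp only [map_add, map_mul, map_div₀, conj_ofReal]
      ring
    rw [h1]
    simp only [map_add, map_mul, map_div₀, conj_ofReal, map_one]
    field_simp
    ring
  rw [Finset.sum_congr rfl fun i _ => key i]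
  simp only [Finset.sum_add_distrib, ← Finset.mul_sum]
  rw [← hL, ← hS, ← hP, ← hT, hT1, hT2, hx', ← hS']
  simp only [Finset.sum_const, Finset.card_univ, Fintype.card_fin, nsmul_eq_mul]
  field_simp
  ring

theorem normSq_sum_mul_le {d : ℕ} (x : Fin d → ℝ) (p : Fin d → ℂ) :
    normSq (∑ i, x i * p i) ≤ (∑ i, x i ^ 2) * ∑ i, normSq (p i) := by
  have h := norm_sum_le Finset.univ fun i => (x i : ℂ) * p i
  have h2 := Finset.sum_mul_sq_le_sq_mul_sq Finset.univ (fun i => |x i|) (fun i => ‖p i‖)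
  simp only [norm_mul, norm_real, Real.norm_eq_abs] at h
  simp only [sq_abs] at h2
  simp only [normSq_eq_norm_sq]
  exact (pow_le_pow_left₀ (norm_nonneg _) h 2).trans h2

/-- The pointwise multiplier inequality. -/
theorem multiplier_inequality {n r : ℝ} (hn : 3 ≤ n) (hr : 0 < r) {k u S Q L T P g : ℂ}
    (hk : 0 ≤ k.im) {P' : ℝ} (hP : P = P') (hS : normSq S ≤ r ^ 2 * P')
    (hQ : Q = S + ((n - 1) / 2 : ℝ) * u) (hg : g = -L - 2 * I * k * Q / r) {b : ℂ}
    (hb : b = (-((n - 1) / 4) + 1 / 8 : ℝ)) :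
    (n - 2) ^ 2 / 16 * (normSq u / r ^ 2) ≤ r ^ 2 * normSq g -
      (-(L * conj Q + I * k / r * S * conj Q + (1 + conj (((n - 1) / 2 : ℝ) : ℂ)) * P + T
        + conj (I * k) / r * conj Q * S) +
      1 / 2 * (n * P + (conj T + T) + (I * k + conj (I * k)) * r * P) +
      b * ((n - 2) / r ^ 2 * (u * conj u) + (S * conj u + u * conj S) / r ^ 2 +
        (I * k + conj (I * k)) / r * (u * conj u))).re := by
  have hr' : (r : ℂ) ≠ 0 := by exact_mod_cast hr.ne'
  have hL : L = -g - 2 * I * k * Q / r := by rw [hg]; ring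
  have hS' : S = Q - ((n - 1) / 2 : ℝ) * u := by rw [hQ]; ring
  -- With `c = (n-1)/2` the coefficient `n/2 - (1 + c)` of `P` is `-1/2`. The part `-(n-1)/4` of `b`
  -- supplies the cross term that trades `|S|²` for `|Q|²`. The remaining `1/8` contributes the last
  -- bracket, a Hardy-type correction.
  have hre : (-(L * conj Q + I * k / r * S * conj Q + (1 + conj (((n - 1) / 2 : ℝ) : ℂ)) * P + T
        + conj (I * k) / r * conj Q * S) +
      1 / 2 * (n * P + (conj T + T) + (I * k + conj (I * k)) * r * P) +
      b * ((n - 2) / r ^ 2 * (u * conj u) + (S * conj u + u * conj S) / r ^ 2 +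
        (I * k + conj (I * k)) / r * (u * conj u))).re =
      (g * conj Q).re - (1 / 2 + k.im * r) * (normSq Q / r ^ 2 + P' - normSq S / r ^ 2) -
      (((n - 1) / 2) ^ 2 - (n - 1) / 2) * (1 / 2 / r ^ 2 + k.im / r) * normSq u +
      1 / 8 * ((2 * (Q * conj u).re - normSq u) / r ^ 2 - 2 * k.im / r * normSq u) := by
    rw [hL, hS', hP, hb]
    obtain ⟨κ, ε⟩ := k
    obtain ⟨q1, q2⟩ := Q
    obtain ⟨t1, t2⟩ := T
    obtain ⟨u1, u2⟩ := u
    obtain ⟨g1, g2⟩ := g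
    have e1 : ∀ a : ℂ, a / (r : ℂ) = a * ((r⁻¹ : ℝ) : ℂ) := by
      intro a; push_cast; exact div_eq_mul_inv _ _
    have e2 : ∀ a : ℂ, a / (r : ℂ) ^ 2 = a * (((r⁻¹) ^ 2 : ℝ) : ℂ) := by
      intro a; push_cast; rw [inv_pow]; exact div_eq_mul_inv _ _
    have e3 : ∀ a : ℂ, 1 / 2 * a = ((1 / 2 : ℝ) : ℂ) * a := by
      intro a; push_cast; ring
    have e4 : ((n : ℂ) - 2) = ((n - 2 : ℝ) : ℂ) := by push_cast; ring
    have e5 : ((2 : ℂ)) = ((2 : ℝ) : ℂ) := by push_cast; ring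
    rw [e3]
    simp only [e1, e2, e4]
    rw [e5]
    simp only [normSq_apply, add_re, neg_re, mul_re, sub_re, I_re, I_im, ofReal_re, ofReal_im,
      conj_re, conj_im, one_re, one_im, add_im, mul_im, sub_im, neg_im]
    field_simp
    ring
  rw [hre]
  have h1 : 0 ≤ (1 / 2 + k.im * r) * (P' - normSq S / r ^ 2) := by
    refine mul_nonneg (by positivity) ?_
    rw [sub_nonneg, div_le_iff₀ (by positivity)]
    linarith
  have h2 : 0 ≤ k.im * r * (normSq Q / r ^ 2) :=
    mul_nonneg (by positivity) (div_nonneg (normSq_nonneg _) (by positivity))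
  -- The coefficient is `(n-1)(n-3)/4`. It vanishes for `n = 3`, where control of `|u|²/r²` comes
  -- only from the `1/8` in `b`.
  have h3 : 0 ≤ (((n - 1) / 2) ^ 2 - (n - 1) / 2) * (k.im / r) * normSq u := by
    refine mul_nonneg (mul_nonneg ?_ (by positivity)) (normSq_nonneg _)
    nlinarith
  have h4 : 0 ≤ k.im / r * normSq u := mul_nonneg (by positivity) (normSq_nonneg _)
  have h5 : 0 ≤ ((n - 2) ^ 2 - 1) * (normSq u / r ^ 2) :=
    mul_nonneg (by nlinarith) (div_nonneg (normSq_nonneg _) (by positivity))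
  -- Young's inequality spends half of the available `|Q|²/(2r²)`. The other half completes the
  -- square `|Q - u/2|²` below, which absorbs the indefinite term `Re (Q conj u)`.
  have h6 : (g * conj Q).re ≤ r ^ 2 * normSq g + 1 / 4 * (normSq Q / r ^ 2) := by
    have := normSq_nonneg ((r : ℂ) * g - (1 / (2 * r) : ℝ) * Q)
    have e : normSq ((r : ℂ) * g - (1 / (2 * r) : ℝ) * Q) =
        r ^ 2 * normSq g + 1 / 4 * (normSq Q / r ^ 2) - (g * conj Q).re := by
      simp only [normSq_apply, sub_re, sub_im, mul_re, mul_im, ofReal_re, ofReal_im, conj_re,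
        conj_im]
      field_simp
      ring
    linarith
  have h7 : 0 ≤ 1 / 4 * (normSq Q / r ^ 2) - 1 / 4 * ((Q * conj u).re / r ^ 2) +
      1 / 16 * (normSq u / r ^ 2) := by
    have := div_nonneg (normSq_nonneg (Q - (1 / 2 : ℝ) * u)) (sq_nonneg r)
    have e : normSq (Q - (1 / 2 : ℝ) * u) / r ^ 2 = 4 * (1 / 4 * (normSq Q / r ^ 2) -
        1 / 4 * ((Q * conj u).re / r ^ 2) + 1 / 16 * (normSq u / r ^ 2)) := by
      simp only [normSq_apply, sub_re, sub_im, mul_re, mul_im, ofReal_re, ofReal_im, conj_re,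
        conj_im]
      field_simp
      ring
    linarith
  have e : r ^ 2 * normSq g - ((g * conj Q).re - (1 / 2 + k.im * r) *
      (normSq Q / r ^ 2 + P' - normSq S / r ^ 2) -
      (((n - 1) / 2) ^ 2 - (n - 1) / 2) * (1 / 2 / r ^ 2 + k.im / r) * normSq u +
      1 / 8 * ((2 * (Q * conj u).re - normSq u) / r ^ 2 - 2 * k.im / r * normSq u)) =
      (n - 2) ^ 2 / 16 * (normSq u / r ^ 2) +
      (r ^ 2 * normSq g + 1 / 4 * (normSq Q / r ^ 2) - (g * conj Q).re) +
      (1 / 2 + k.im * r) * (P' - normSq S / r ^ 2) + k.im * r * (normSq Q / r ^ 2) +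
      (((n - 1) / 2) ^ 2 - (n - 1) / 2) * (k.im / r) * normSq u +
      1 / 4 * (k.im / r * normSq u) + 1 / 16 * (((n - 2) ^ 2 - 1) * (normSq u / r ^ 2)) +
      (1 / 4 * (normSq Q / r ^ 2) - 1 / 4 * ((Q * conj u).re / r ^ 2) +
      1 / 16 * (normSq u / r ^ 2)) := by
    field_simp
    ring
  rw [e]
  linarith

/-! ### Twisted derivatives and the divergence of the current -/

variable {d : ℕ}


/-- The partial derivative in the `i`-th coordinate. -/
def pderiv (i : Fin d) (f : EuclideanSpace ℝ (Fin d) → ℂ) (x : EuclideanSpace ℝ (Fin d)) : ℂ :=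
  fderiv ℝ f x (EuclideanSpace.single i 1)

/-- The gradient of `u`, twisted by the phase `exp (i k |x|)`. -/
def twistedGrad (k : ℂ) (u : EuclideanSpace ℝ (Fin d) → ℂ) (i : Fin d)
    (x : EuclideanSpace ℝ (Fin d)) : ℂ :=
  pderiv i u x - I * k * (x i / ‖x‖) * u x

/-- The multiplier `x · (twisted gradient of u) + c u`. -/
def multiplier (k c : ℂ) (u : EuclideanSpace ℝ (Fin d) → ℂ) (x : EuclideanSpace ℝ (Fin d)) : ℂ :=
  ∑ j, x j * twistedGrad k u j x + c * u x

/-- The current whose divergence controls `|u|² / |x|²`. -/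
def current (k c b : ℂ) (u : EuclideanSpace ℝ (Fin d) → ℂ) (i : Fin d)
    (x : EuclideanSpace ℝ (Fin d)) : ℂ :=
  -(twistedGrad k u i x * conj (multiplier k c u x)) +
    1 / 2 * (x i * ∑ j, twistedGrad k u j x * conj (twistedGrad k u j x)) +
    b * (x i / ‖x‖ ^ 2 * (u x * conj (u x)))

theorem HasDerivAt.conj {f : ℝ → ℂ} {f' : ℂ} {t : ℝ} (h : HasDerivAt f f' t) :
    HasDerivAt (fun s => conj (f s)) (conj f') t := h.star

theorem hasLineDerivAt_coord (i j : Fin d) (x : EuclideanSpace ℝ (Fin d)) :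
    HasDerivAt (fun t : ℝ => (((x + t • EuclideanSpace.single i (1 : ℝ)) j : ℝ) : ℂ))
      (if j = i then 1 else 0) 0 := by
  have : (fun t : ℝ => (((x + t • EuclideanSpace.single i (1 : ℝ)) j : ℝ) : ℂ)) =
      fun t : ℝ => (x j : ℂ) + (t : ℂ) * (if j = i then 1 else 0) := by
    ext t
    by_cases h : j = i <;> simp [h]
  rw [this]
  simpa using ((hasDerivAt_id (0 : ℝ)).ofReal_comp.mul_const (if j = i then (1 : ℂ) else 0)).const_add
    (x j : ℂ)

theorem hasLineDerivAt_norm_real (i : Fin d) {x : EuclideanSpace ℝ (Fin d)} (hx : x ≠ 0) :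
    HasDerivAt (fun t : ℝ => ‖x + t • EuclideanSpace.single i (1 : ℝ)‖) (x i / ‖x‖) 0 := by
  have h1 : HasDerivAt (fun t : ℝ => x + t • EuclideanSpace.single i (1 : ℝ))
      (EuclideanSpace.single i (1 : ℝ)) 0 := by
    simpa using ((hasDerivAt_id (0 : ℝ)).smul_const (EuclideanSpace.single i (1 : ℝ))).const_add x
  have h3 := h1.norm_sq.sqrt (by simpa using hx)
  simp only [Real.sqrt_sq (norm_nonneg _)] at h3
  refine h3.congr_deriv ?_
  have : ‖x‖ ≠ 0 := (norm_pos_iff.2 hx).ne'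
  simp only [zero_smul, add_zero, EuclideanSpace.inner_single_right, one_mul, conj_trivial]
  field_simp

theorem hasLineDerivAt_norm (i : Fin d) {x : EuclideanSpace ℝ (Fin d)} (hx : x ≠ 0) :
    HasDerivAt (fun t : ℝ => ((‖x + t • EuclideanSpace.single i (1 : ℝ)‖ : ℝ) : ℂ))
      (x i / ‖x‖) 0 := by
  simpa using (hasLineDerivAt_norm_real i hx).ofReal_comp

theorem hasLineDerivAt_of_differentiableAt {f : EuclideanSpace ℝ (Fin d) → ℂ} (i : Fin d)
    {x : EuclideanSpace ℝ (Fin d)} (hf : DifferentiableAt ℝ f x) :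
    HasDerivAt (fun t : ℝ => f (x + t • EuclideanSpace.single i (1 : ℝ))) (pderiv i f x) 0 :=
  hf.hasFDerivAt.hasLineDerivAt _

/-- The twisted Hessian. -/
def twistedHess (k : ℂ) (u : EuclideanSpace ℝ (Fin d) → ℂ) (x : EuclideanSpace ℝ (Fin d))
    (i j : Fin d) : ℂ :=
  pderiv i (pderiv j u) x - I * k * ((if j = i then 1 else 0) / ‖x‖ - x i * x j / ‖x‖ ^ 3) * u x -
    I * k * (x j / ‖x‖) * pderiv i u x - I * k * (x i / ‖x‖) * twistedGrad k u j x

/-- An ordinary derivative is the covariant one plus multiplication by `ik x_i/|x|`, the logarithmic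
derivative of `e^{ik|x|}`. Keeping the two apart gives the form needed in `sum_current_deriv`. -/
theorem hasLineDerivAt_twistedGrad {k : ℂ} {u : EuclideanSpace ℝ (Fin d) → ℂ}
    {x : EuclideanSpace ℝ (Fin d)} (hx : x ≠ 0) (hu : DifferentiableAt ℝ u x) (i j : Fin d)
    (hu' : DifferentiableAt ℝ (pderiv j u) x) :
    HasDerivAt (fun t : ℝ => twistedGrad k u j (x + t • EuclideanSpace.single i (1 : ℝ)))
      (twistedHess k u x i j + I * k * (x i / ‖x‖) * twistedGrad k u j x) 0 := by
  have hr : ((‖x‖ : ℝ) : ℂ) ≠ 0 := by exact_mod_cast (norm_pos_iff.2 hx).ne'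
  have h := (hasLineDerivAt_of_differentiableAt i hu').sub
    ((((hasLineDerivAt_coord i j x).div (hasLineDerivAt_norm i hx) (by simpa using hx)).const_mul
      (I * k)).mul (hasLineDerivAt_of_differentiableAt i hu))
  refine h.congr_deriv ?_
  simp only [twistedHess, zero_smul, add_zero, twistedGrad, Pi.div_apply]
  field_simp
  ring

theorem hasLineDerivAt_multiplier {k c : ℂ} {u : EuclideanSpace ℝ (Fin d) → ℂ}
    {x : EuclideanSpace ℝ (Fin d)} (hx : x ≠ 0) (hu : DifferentiableAt ℝ u x) (i : Fin d)
    (hu' : ∀ j, DifferentiableAt ℝ (pderiv j u) x) :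
    HasDerivAt (fun t : ℝ => multiplier k c u (x + t • EuclideanSpace.single i (1 : ℝ)))
      ((1 + c) * twistedGrad k u i x + ∑ j, x j * twistedHess k u x i j +
        I * k * (x i / ‖x‖) * multiplier k c u x) 0 := by
  have hr : ((‖x‖ : ℝ) : ℂ) ≠ 0 := by exact_mod_cast (norm_pos_iff.2 hx).ne'
  have h := (HasDerivAt.fun_sum (u := Finset.univ) fun j _ => (hasLineDerivAt_coord i j x).mul
    (hasLineDerivAt_twistedGrad (k := k) hx hu i j (hu' j))).add
    ((hasLineDerivAt_of_differentiableAt i hu).const_mul c)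
  refine h.congr_deriv ?_
  have e : pderiv i u x = twistedGrad k u i x + I * k * (x i / ‖x‖) * u x := by
    rw [twistedGrad]; ring
  simp only [zero_smul, add_zero, Finset.sum_add_distrib, ite_mul, one_mul, zero_mul,
    Finset.sum_ite_eq', Finset.mem_univ, if_true, multiplier, mul_add, Finset.mul_sum, e]
  rw [show ∑ j, (x j : ℂ) * (I * k * (x i / ‖x‖) * twistedGrad k u j x) =
    ∑ j, I * k * (x i / ‖x‖) * (x j * twistedGrad k u j x) from
    Finset.sum_congr rfl fun j _ => by ring]
  ring

theorem hasLineDerivAt_current {k c b : ℂ} {u : EuclideanSpace ℝ (Fin d) → ℂ}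
    {x : EuclideanSpace ℝ (Fin d)} (hx : x ≠ 0) (hu : DifferentiableAt ℝ u x) (i : Fin d)
    (hu' : ∀ j, DifferentiableAt ℝ (pderiv j u) x) :
    HasDerivAt (fun t : ℝ => current k c b u i (x + t • EuclideanSpace.single i (1 : ℝ)))
      (-((twistedHess k u x i i + I * k * (x i / ‖x‖) * twistedGrad k u i x) *
          conj (multiplier k c u x) +
        twistedGrad k u i x * conj ((1 + c) * twistedGrad k u i x +
          ∑ j, x j * twistedHess k u x i j + I * k * (x i / ‖x‖) * multiplier k c u x)) +
      1 / 2 * (∑ j, twistedGrad k u j x * conj (twistedGrad k u j x) +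
        x i * ∑ j, ((twistedHess k u x i j + I * k * (x i / ‖x‖) * twistedGrad k u j x) *
            conj (twistedGrad k u j x) +
          twistedGrad k u j x *
            conj (twistedHess k u x i j + I * k * (x i / ‖x‖) * twistedGrad k u j x))) +
      b * ((1 / ‖x‖ ^ 2 - 2 * x i ^ 2 / ‖x‖ ^ 4) * (u x * conj (u x)) + x i / ‖x‖ ^ 2 *
        ((twistedGrad k u i x + I * k * (x i / ‖x‖) * u x) * conj (u x) +
          u x * conj (twistedGrad k u i x + I * k * (x i / ‖x‖) * u x)))) 0 := by
  have hr : ((‖x‖ : ℝ) : ℂ) ≠ 0 := by exact_mod_cast (norm_pos_iff.2 hx).ne'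
  have hp := fun j => hasLineDerivAt_twistedGrad (k := k) hx hu i j (hu' j)
  have hQ := hasLineDerivAt_multiplier (k := k) (c := c) hx hu i hu'
  have hU := hasLineDerivAt_of_differentiableAt i hu
  have h := ((((hp i).mul (HasDerivAt.conj hQ)).neg).add
    (((hasLineDerivAt_coord i i x).mul (HasDerivAt.fun_sum (u := Finset.univ) fun j _ =>
      (hp j).mul (HasDerivAt.conj (hp j)))).const_mul (1 / 2))).add
    ((((hasLineDerivAt_coord i i x).div ((hasLineDerivAt_norm i hx).pow 2)
      (by simpa using hx)).mul (hU.mul (HasDerivAt.conj hU))).const_mul b)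
  refine h.congr_deriv ?_
  have e : twistedGrad k u i x + I * k * (x i / ‖x‖) * u x = pderiv i u x := by
    rw [twistedGrad]; ring
  simp only [zero_smul, add_zero, if_true, e, Pi.pow_apply, Pi.mul_apply, Pi.div_apply]
  congr 1
  · congr 1
    simp only [one_mul]
  · congr 2
    congr 1
    push_cast
    field_simp

theorem contDiff_pderiv {m n : WithTop ℕ∞} {u : EuclideanSpace ℝ (Fin d) → ℂ} (hu : ContDiff ℝ n u)
    (hm : m + 1 ≤ n) (i : Fin d) : ContDiff ℝ m (pderiv i u) :=
  (hu.fderiv_right hm).clm_apply contDiff_const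

theorem pderiv_pderiv_comm {u : EuclideanSpace ℝ (Fin d) → ℂ} (hu : ContDiff ℝ 2 u)
    (x : EuclideanSpace ℝ (Fin d)) (i j : Fin d) :
    pderiv i (pderiv j u) x = pderiv j (pderiv i u) x := by
  have hd : DifferentiableAt ℝ (fderiv ℝ u) x :=
    ((hu.fderiv_right (m := 1) (by norm_num)).differentiable (by norm_num)).differentiableAt
  have h : ∀ i j : Fin d, pderiv i (pderiv j u) x =
      fderiv ℝ (fderiv ℝ u) x (EuclideanSpace.single i 1) (EuclideanSpace.single j 1) := by
    intro i j
    change fderiv ℝ (fun y => fderiv ℝ u y (EuclideanSpace.single j 1)) x _ = _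
    rw [fderiv_clm_apply hd (differentiableAt_const _)]
    simp
  rw [h, h]
  exact (hu.contDiffAt.isSymmSndFDerivAt (by simp)) _ _

theorem contDiffAt_conj {E : Type*} [NormedAddCommGroup E] [NormedSpace ℝ E] {n : WithTop ℕ∞}
    {f : E → ℂ} {x : E} (hf : ContDiffAt ℝ n f x) : ContDiffAt ℝ n (fun y => conj (f y)) x :=
  conjCLE.contDiff.contDiffAt.comp x hf

theorem contDiffAt_div {E : Type*} [NormedAddCommGroup E] [NormedSpace ℝ E] {n : WithTop ℕ∞}
    {f g : E → ℂ} {x : E} (hf : ContDiffAt ℝ n f x) (hg : ContDiffAt ℝ n g x) (hx : g x ≠ 0) :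
    ContDiffAt ℝ n (fun y => f y / g y) x := by
  simpa only [div_eq_mul_inv, Pi.inv_apply] using! hf.mul (hg.inv hx)

theorem contDiffAt_current {k c b : ℂ} {u : EuclideanSpace ℝ (Fin d) → ℂ} (hu : ContDiff ℝ 2 u)
    {x : EuclideanSpace ℝ (Fin d)} (hx : x ≠ 0) (i : Fin d) :
    ContDiffAt ℝ 1 (current k c b u i) x := by
  have hr : ContDiffAt ℝ 1 (fun y : EuclideanSpace ℝ (Fin d) => ((‖y‖ : ℝ) : ℂ)) x :=
    ofRealCLM.contDiff.contDiffAt.comp x (contDiffAt_norm ℝ hx)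
  have hr0 : ((‖x‖ : ℝ) : ℂ) ≠ 0 := by simpa using hx
  have hc : ∀ j, ContDiffAt ℝ 1 (fun y : EuclideanSpace ℝ (Fin d) => ((y j : ℝ) : ℂ)) x := fun j =>
    ofRealCLM.contDiff.contDiffAt.comp x (EuclideanSpace.proj (𝕜 := ℝ) j).contDiff.contDiffAt
  have hu1 : ContDiffAt ℝ 1 u x := (hu.of_le (by norm_num)).contDiffAt
  have hp : ∀ j, ContDiffAt ℝ 1 (twistedGrad k u j) x := fun j =>
    (contDiff_pderiv hu (by norm_num) j).contDiffAt.sub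
      ((contDiffAt_const.mul (contDiffAt_div (hc j) hr hr0)).mul hu1)
  have hQ : ContDiffAt ℝ 1 (multiplier k c u) x :=
    (ContDiffAt.sum fun j _ => (hc j).mul (hp j)).add (contDiffAt_const.mul hu1)
  exact ((((hp i).mul (contDiffAt_conj hQ)).neg).add (contDiffAt_const.mul ((hc i).mul
    (ContDiffAt.sum fun j _ => (hp j).mul (contDiffAt_conj (hp j)))))).add
    (contDiffAt_const.mul ((contDiffAt_div (hc i) (hr.pow 2) (pow_ne_zero 2 hr0)).mul
      (hu1.mul (contDiffAt_conj hu1))))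

theorem sum_sq_coord (x : EuclideanSpace ℝ (Fin d)) : ∑ i, x i ^ 2 = ‖x‖ ^ 2 := by
  rw [EuclideanSpace.real_norm_sq_eq]

/-- The multiplier inequality, for the divergence of the current. -/
theorem normSq_div_le_sub_div_current (hd : 3 ≤ d) {k : ℂ} (hk : 0 ≤ k.im)
    {u : EuclideanSpace ℝ (Fin d) → ℂ} (hu : ContDiff ℝ 2 u) {x : EuclideanSpace ℝ (Fin d)}
    (hx : x ≠ 0) :
    ((d : ℝ) - 2) ^ 2 / 16 * (normSq (u x) / ‖x‖ ^ 2) ≤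
      ‖x‖ ^ 2 * normSq (-∑ i, pderiv i (pderiv i u) x - k ^ 2 * u x) -
      (∑ i, pderiv i (current k (((d : ℝ) - 1) / 2 : ℝ) (-(((d : ℝ) - 1) / 4) + 1 / 8 : ℝ) u i)
        x).re := by
  have hr : 0 < ‖x‖ := norm_pos_iff.2 hx
  have hr0 : ((‖x‖ : ℝ) : ℂ) ≠ 0 := by exact_mod_cast hr.ne'
  have hu1 : DifferentiableAt ℝ u x := (hu.differentiable (by norm_num)).differentiableAt
  have hu2 : ∀ j, DifferentiableAt ℝ (pderiv j u) x := fun j =>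
    ((contDiff_pderiv (m := 1) hu (by norm_num) j).differentiable (by norm_num)).differentiableAt
  have hM : ∀ i j, twistedHess k u x i j = twistedHess k u x j i := by
    intro i j
    simp only [twistedHess, twistedGrad, pderiv_pderiv_comm hu x i j, eq_comm (a := i)]
    ring
  rw [Finset.sum_congr rfl fun i _ => (hasLineDerivAt_of_differentiableAt i
    ((contDiffAt_current hu hx i).differentiableAt (by norm_num))).unique
    (hasLineDerivAt_current hx hu1 i hu2),
    sum_current_deriv x ‖x‖ hr (sum_sq_coord x) k _ (u x) (fun i => twistedGrad k u i x)
      (twistedHess k u x) hM _ (∑ i, x i * twistedGrad k u i x) (multiplier k _ u x) _ _ rfl rfl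
      rfl rfl]
  have hP : ∑ i, twistedGrad k u i x * conj (twistedGrad k u i x) =
      ((∑ i, normSq (twistedGrad k u i x) : ℝ) : ℂ) := by
    push_cast
    exact Finset.sum_congr rfl fun i _ => mul_conj _
  refine (multiplier_inequality (n := d) (by exact_mod_cast hd) hr hk hP
    (S := ∑ i, x i * twistedGrad k u i x) (Q := multiplier k (((d : ℝ) - 1) / 2 : ℝ) u x)
    (L := ∑ i, twistedHess k u x i i)
    (T := ∑ i, twistedGrad k u i x * conj (∑ j, x j * twistedHess k u x i j))
    (g := -∑ i, pderiv i (pderiv i u) x - k ^ 2 * u x) ?_ rfl ?_ rfl).trans_eq ?_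
  · rw [← sum_sq_coord x]
    exact normSq_sum_mul_le (fun i => x i) _
  -- Taking the trace gives `Δu + k²u = L + 2ik Q/|x|`. The constant `(d-1)/2` in `Q` is forced
  -- here, because `div (x/|x|) = (d-1)/|x|`.
  · have h1 : ∀ i, twistedHess k u x i i = pderiv i (pderiv i u) x - I * k / ‖x‖ * u x * 1 +
        (I * k * u x / ‖x‖ ^ 3 - (I * k) ^ 2 / ‖x‖ ^ 2 * u x) * (x i : ℂ) ^ 2 -
        2 * I * k / ‖x‖ * (x i * twistedGrad k u i x) := by
      intro i
      simp only [twistedHess, twistedGrad, if_true]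
      field_simp
      ring
    have h2 : ∑ i, (x i : ℂ) ^ 2 = ‖x‖ ^ 2 := by exact_mod_cast congrArg ((↑) : ℝ → ℂ) (sum_sq_coord x)
    rw [Finset.sum_congr rfl fun i _ => h1 i]
    simp only [Finset.sum_add_distrib, Finset.sum_sub_distrib, ← Finset.mul_sum, h2, multiplier]
    simp only [Finset.sum_const, Finset.card_univ, Fintype.card_fin, nsmul_eq_mul]
    push_cast
    field_simp
    ring_nf
    simp only [I_sq]
    ring
  · simp

/-- Only the factor `‖x‖` times an integrable density matters. The constant may depend on `k`, since
the term bounded by it disappears in the cutoff limit. -/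
theorem norm_current_le (k c b : ℂ) (u : EuclideanSpace ℝ (Fin d) → ℂ)
    {x : EuclideanSpace ℝ (Fin d)} (hx : x ≠ 0) (i : Fin d) :
    ‖current k c b u i x‖ ≤ ((1 + d * ‖k‖) ^ 2 + ‖c‖ * (1 + d * ‖k‖) + (1 + d * ‖k‖) ^ 2 / 2 + ‖b‖) *
      (‖x‖ * (∑ j, ‖pderiv j u x‖ + ‖u x‖ + ‖u x‖ / ‖x‖) ^ 2) := by
  have hr : 0 < ‖x‖ := norm_pos_iff.2 hx
  set a : ℝ := 1 + d * ‖k‖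
  set B := ∑ j, ‖pderiv j u x‖ + ‖u x‖ + ‖u x‖ / ‖x‖ with hB
  have ha : 1 ≤ a := by simp only [a]; nlinarith [norm_nonneg k, (Nat.cast_nonneg d : (0 : ℝ) ≤ d)]
  have hs : 0 ≤ ∑ j, ‖pderiv j u x‖ := Finset.sum_nonneg fun _ _ => norm_nonneg _
  have hq : 0 ≤ ‖u x‖ / ‖x‖ := by positivity
  have hB0 : 0 ≤ B := by positivity
  have huB : ‖u x‖ / ‖x‖ ≤ B := by rw [hB]; linarith [norm_nonneg (u x)]
  have hxi : ∀ j, ‖((x j : ℝ) : ℂ)‖ ≤ ‖x‖ := fun j => by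
    rw [norm_real]; exact PiLp.norm_apply_le x j
  have hpj : ∀ j, ‖twistedGrad k u j x‖ ≤ ‖pderiv j u x‖ + ‖k‖ * ‖u x‖ := by
    intro j
    refine (norm_sub_le _ _).trans (add_le_add le_rfl ?_)
    rw [norm_mul, norm_mul, norm_mul, norm_I, one_mul, norm_div, norm_real ‖x‖, norm_norm]
    have : ‖((x j : ℝ) : ℂ)‖ / ‖x‖ ≤ 1 := by rw [div_le_one hr]; exact hxi j
    calc ‖k‖ * (‖((x j : ℝ) : ℂ)‖ / ‖x‖) * ‖u x‖ ≤ ‖k‖ * 1 * ‖u x‖ := by gcongr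
      _ = _ := by ring
  have hA : ∑ j, ‖twistedGrad k u j x‖ ≤ a * B := by
    refine (Finset.sum_le_sum fun j _ => hpj j).trans ?_
    rw [Finset.sum_add_distrib, Finset.sum_const, Finset.card_univ, Fintype.card_fin, nsmul_eq_mul]
    have : 0 ≤ (d : ℝ) * ‖k‖ := by positivity
    simp only [a, hB]
    nlinarith [norm_nonneg (u x)]
  have hA0 : 0 ≤ ∑ j, ‖twistedGrad k u j x‖ := Finset.sum_nonneg fun _ _ => norm_nonneg _
  have hpi : ‖twistedGrad k u i x‖ ≤ a * B :=
    (Finset.single_le_sum (f := fun j => ‖twistedGrad k u j x‖) (fun _ _ => norm_nonneg _)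
      (Finset.mem_univ i)).trans hA
  have hQ : ‖multiplier k c u x‖ ≤ ‖x‖ * (a * B + ‖c‖ * B) := by
    have h1 : ‖∑ j, (x j : ℂ) * twistedGrad k u j x‖ ≤ ‖x‖ * (a * B) := by
      refine (norm_sum_le _ _).trans (le_trans ?_ (mul_le_mul_of_nonneg_left hA hr.le))
      rw [Finset.mul_sum]
      refine Finset.sum_le_sum fun j _ => ?_
      rw [norm_mul]
      exact mul_le_mul_of_nonneg_right (hxi j) (norm_nonneg _)
    have h2 : ‖c * u x‖ ≤ ‖x‖ * (‖c‖ * B) := by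
      rw [norm_mul]
      calc ‖c‖ * ‖u x‖ = ‖x‖ * (‖c‖ * (‖u x‖ / ‖x‖)) := by field_simp
        _ ≤ _ := by gcongr
    rw [mul_add]
    exact (norm_add_le _ _).trans (add_le_add h1 h2)
  have hP : ‖∑ j, twistedGrad k u j x * conj (twistedGrad k u j x)‖ ≤ (a * B) ^ 2 := by
    refine (norm_sum_le _ _).trans ?_
    calc ∑ j, ‖twistedGrad k u j x * conj (twistedGrad k u j x)‖
        ≤ ∑ j, ‖twistedGrad k u j x‖ * (a * B) := by
          refine Finset.sum_le_sum fun j _ => ?_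
          rw [norm_mul, RCLike.norm_conj]
          refine mul_le_mul_of_nonneg_left ?_ (norm_nonneg _)
          exact (Finset.single_le_sum (f := fun j => ‖twistedGrad k u j x‖)
            (fun _ _ => norm_nonneg _) (Finset.mem_univ j)).trans hA
      _ = (∑ j, ‖twistedGrad k u j x‖) * (a * B) := by rw [Finset.sum_mul]
      _ ≤ (a * B) * (a * B) := by gcongr
      _ = _ := by ring
  have t1 : ‖-(twistedGrad k u i x * conj (multiplier k c u x))‖ ≤
      (a * B) * (‖x‖ * (a * B + ‖c‖ * B)) := by
    rw [norm_neg, norm_mul, RCLike.norm_conj]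
    gcongr
  have t2 : ‖1 / 2 * (x i * ∑ j, twistedGrad k u j x * conj (twistedGrad k u j x))‖ ≤
      1 / 2 * (‖x‖ * (a * B) ^ 2) := by
    rw [norm_mul, norm_mul]
    have : ‖(1 / 2 : ℂ)‖ = 1 / 2 := by norm_num
    rw [this]
    gcongr
    exact hxi i
  have t3 : ‖b * (x i / ‖x‖ ^ 2 * (u x * conj (u x)))‖ ≤ ‖b‖ * (‖x‖ * B ^ 2) := by
    rw [norm_mul, norm_mul, norm_mul, RCLike.norm_conj, norm_div, norm_pow, norm_real ‖x‖, norm_norm]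
    refine mul_le_mul_of_nonneg_left ?_ (norm_nonneg _)
    calc ‖((x i : ℝ) : ℂ)‖ / ‖x‖ ^ 2 * (‖u x‖ * ‖u x‖) ≤ ‖x‖ / ‖x‖ ^ 2 * (‖u x‖ * ‖u x‖) := by
          gcongr; exact hxi i
      _ = ‖x‖ * (‖u x‖ / ‖x‖) ^ 2 := by field_simp
      _ ≤ _ := by gcongr
  refine ((norm_add_le _ _).trans (add_le_add ((norm_add_le _ _).trans (add_le_add t1 t2))
    t3)).trans_eq ?_
  ring

/-! ### Logarithmic cutoffs and the integrated estimate -/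

theorem integral_pderiv_eq_zero {F : EuclideanSpace ℝ (Fin d) → ℂ} (hF : ContDiff ℝ 1 F)
    (hc : HasCompactSupport F) (i : Fin d) :
    Integrable (pderiv i F) ∧ ∫ x, pderiv i F x = 0 := by
  have h1 : Integrable (pderiv i F) :=
    (contDiff_pderiv (m := 0) hF (by norm_num) i).continuous.integrable_of_hasCompactSupport
      (hc.fderiv_apply ℝ _)
  refine ⟨h1, ?_⟩
  have h := integral_mul_fderiv_eq_neg_fderiv_mul_of_integrable (μ := volume) (𝕜 := ℂ)
    (f := fun _ : EuclideanSpace ℝ (Fin d) => (1 : ℂ)) (g := F)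
    (v := EuclideanSpace.single i 1) (by simp) (by simp only [one_mul]; exact h1)
    (by simpa using hF.continuous.integrable_of_hasCompactSupport hc)
    (fun x _ => differentiableAt_const _)
    (fun x _ => (hF.differentiable (by norm_num)).differentiableAt)
  simp only [one_mul, fderiv_fun_const, Pi.zero_apply, _root_.zero_apply, zero_mul,
    integral_zero, neg_zero] at h
  exact h

/-- The smooth function on the line used for logarithmic cutoffs. -/
def logBump : ContDiffBump (0 : ℝ) := ⟨1, 2, one_pos, one_lt_two⟩

/-- A cutoff away from the origin and infinity, at logarithmic scale `n + 1`. -/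
def cutoff (n : ℕ) (x : EuclideanSpace ℝ (Fin d)) : ℝ :=
  -- Since `Real.log 0 = 0`, the bump alone would take the value `1` at the origin.
  if x = 0 then 0 else logBump (Real.log ‖x‖ / (n + 1))

theorem cutoff_nonneg (n : ℕ) (x : EuclideanSpace ℝ (Fin d)) : 0 ≤ cutoff n x := by
  unfold cutoff
  split_ifs
  · exact le_rfl
  · exact logBump.nonneg

theorem cutoff_le_one (n : ℕ) (x : EuclideanSpace ℝ (Fin d)) : cutoff n x ≤ 1 := by
  unfold cutoff
  split_ifs
  · exact zero_le_one
  · exact logBump.le_one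

theorem cutoff_eventuallyEq (n : ℕ) {x : EuclideanSpace ℝ (Fin d)} (hx : x ≠ 0) :
    cutoff n =ᶠ[𝓝 x] fun y => logBump (Real.log ‖y‖ / (n + 1)) := by
  filter_upwards [isOpen_ne.mem_nhds hx] with y hy
  exact if_neg hy

theorem cutoff_eq_zero (n : ℕ) {x : EuclideanSpace ℝ (Fin d)}
    (h : 2 * ((n : ℝ) + 1) ≤ |Real.log ‖x‖|) : cutoff n x = 0 := by
  unfold cutoff
  split_ifs
  · rfl
  · refine logBump.zero_of_le_dist ?_
    rw [Real.dist_eq, sub_zero, abs_div, abs_of_pos (by positivity : (0 : ℝ) < n + 1),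
      le_div_iff₀ (by positivity)]
    exact h

theorem cutoff_eventually_zero (n : ℕ) :
    ∀ᶠ x : EuclideanSpace ℝ (Fin d) in 𝓝 0, cutoff n x = 0 := by
  filter_upwards [Metric.ball_mem_nhds (0 : EuclideanSpace ℝ (Fin d))
    (Real.exp_pos (-(2 * ((n : ℝ) + 1))))] with x hx
  by_cases h : x = 0
  · exact if_pos h
  refine cutoff_eq_zero n ?_
  rw [mem_ball_zero_iff] at hx
  have := (Real.log_lt_iff_lt_exp (norm_pos_iff.2 h)).2 hx
  rw [le_abs]
  right
  linarith

theorem hasCompactSupport_cutoff (n : ℕ) :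
    HasCompactSupport (cutoff n : EuclideanSpace ℝ (Fin d) → ℝ) := by
  refine HasCompactSupport.intro (isCompact_closedBall 0 (Real.exp (2 * ((n : ℝ) + 1))))
    fun x hx => cutoff_eq_zero n ?_
  rw [mem_closedBall_zero_iff, not_le] at hx
  exact ((Real.lt_log_iff_exp_lt ((Real.exp_pos _).trans hx)).2 hx).le.trans (le_abs_self _)

theorem contDiff_cutoff (n : ℕ) : ContDiff ℝ 1 (cutoff n : EuclideanSpace ℝ (Fin d) → ℝ) := by
  refine contDiff_iff_contDiffAt.2 fun x => ?_
  by_cases hx : x = 0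
  · subst hx
    exact contDiffAt_const.congr_of_eventuallyEq (cutoff_eventually_zero n)
  · refine ContDiffAt.congr_of_eventuallyEq ?_ (cutoff_eventuallyEq n hx)
    exact logBump.contDiff.contDiffAt.comp x
      (((contDiffAt_norm ℝ hx).log (norm_ne_zero_iff.2 hx)).div_const _)

/-- The chain rule through `log ‖x‖ / (n + 1)` produces both factors: `1/‖x‖` cancels the weight in
`norm_current_le`, and `1/(n + 1)` sends the cutoff error to zero. -/
theorem exists_abs_fderiv_cutoff_le : ∃ K : ℝ, 0 ≤ K ∧
    ∀ (n : ℕ) (x : EuclideanSpace ℝ (Fin d)), x ≠ 0 → ∀ i : Fin d,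
    |fderiv ℝ (cutoff n) x (EuclideanSpace.single i 1)| ≤ K / ((n + 1) * ‖x‖) := by
  have hb : ContDiff ℝ 1 logBump := logBump.contDiff
  obtain ⟨K, hK⟩ := (hb.continuous_deriv le_rfl).bounded_above_of_compact_support
    logBump.hasCompactSupport.deriv
  refine ⟨K, (norm_nonneg _).trans (hK 0), fun n x hx i => ?_⟩
  have hr : 0 < ‖x‖ := norm_pos_iff.2 hx
  have h1 := (((contDiff_cutoff n).differentiable one_ne_zero).differentiableAt (x := x)).hasFDerivAt
    |>.hasLineDerivAt (EuclideanSpace.single i (1 : ℝ))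
  have h2 := (hb.differentiable one_ne_zero).differentiableAt.hasDerivAt.comp 0
    (((hasLineDerivAt_norm_real i hx).log (by simpa using hx)).div_const ((n : ℝ) + 1))
  have hc : Tendsto (fun t : ℝ => x + t • EuclideanSpace.single i (1 : ℝ)) (𝓝 0) (𝓝 x) := by
    have : Continuous fun t : ℝ => x + t • EuclideanSpace.single i (1 : ℝ) := by fun_prop
    simpa using this.tendsto 0
  have h3 := h1.unique (HasDerivAt.congr_of_eventuallyEq h2
    (hc.eventually (cutoff_eventuallyEq n hx)))
  rw [h3, abs_mul, zero_smul, add_zero, abs_div, abs_div, abs_div,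
    abs_of_pos (by positivity : (0 : ℝ) < n + 1), abs_norm]
  have h4 : |x i| ≤ ‖x‖ := PiLp.norm_apply_le x i
  have h5 : |x i| / ‖x‖ / ‖x‖ / ((n : ℝ) + 1) ≤ 1 / ((n + 1) * ‖x‖) := by
    rw [div_div, div_div, div_le_div_iff₀ (by positivity) (by positivity)]
    nlinarith [mul_pos hr (by positivity : (0 : ℝ) < n + 1)]
  calc _ ≤ K * (1 / ((n + 1) * ‖x‖)) := by
        refine mul_le_mul (hK _) h5 (by positivity) ((norm_nonneg _).trans (hK 0))
    _ = _ := by ring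

theorem tendsto_cutoff {x : EuclideanSpace ℝ (Fin d)} (hx : x ≠ 0) :
    Tendsto (fun n => cutoff n x) atTop (𝓝 1) := by
  have h : Tendsto (fun n : ℕ => |Real.log ‖x‖| / ((n : ℝ) + 1)) atTop (𝓝 0) :=
    tendsto_const_nhds.div_atTop (tendsto_atTop_add_const_right _ _ tendsto_natCast_atTop_atTop)
  refine tendsto_const_nhds.congr' ?_
  filter_upwards [h.eventually (gt_mem_nhds one_pos)] with n hn
  rw [cutoff, if_neg hx]
  refine (logBump.one_of_mem_closedBall ?_).symm
  rw [mem_closedBall_zero_iff, Real.norm_eq_abs, abs_div,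
    abs_of_pos (by positivity : (0 : ℝ) < n + 1)]
  exact hn.le

/-- The weighted resolvent estimate for smooth functions. -/
theorem integral_normSq_div_le (hd : 3 ≤ d) {k : ℂ} (hk : 0 ≤ k.im)
    {u : EuclideanSpace ℝ (Fin d) → ℂ} (hu : ContDiff ℝ 2 u)
    (hB : Integrable fun x => (∑ j, ‖pderiv j u x‖ + ‖u x‖ + ‖u x‖ / ‖x‖) ^ 2)
    (hg : Integrable fun x => ‖x‖ ^ 2 * normSq (-∑ i, pderiv i (pderiv i u) x - k ^ 2 * u x)) :
    ∫ x, ((d : ℝ) - 2) ^ 2 / 16 * (normSq (u x) / ‖x‖ ^ 2) ≤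
      ∫ x, ‖x‖ ^ 2 * normSq (-∑ i, pderiv i (pderiv i u) x - k ^ 2 * u x) := by
  obtain ⟨K, hK0, hK⟩ := exists_abs_fderiv_cutoff_le (d := d)
  set c : ℂ := ((((d : ℝ) - 1) / 2 : ℝ) : ℂ)
  set b : ℂ := ((-(((d : ℝ) - 1) / 4) + 1 / 8 : ℝ) : ℂ)
  set B := fun x => (∑ j, ‖pderiv j u x‖ + ‖u x‖ + ‖u x‖ / ‖x‖) ^ 2
  set C : ℝ := (1 + d * ‖k‖) ^ 2 + ‖c‖ * (1 + d * ‖k‖) + (1 + d * ‖k‖) ^ 2 / 2 + ‖b‖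
  set G := fun x => ‖x‖ ^ 2 * normSq (-∑ i, pderiv i (pderiv i u) x - k ^ 2 * u x)
  set N := fun x => ((d : ℝ) - 2) ^ 2 / 16 * (normSq (u x) / ‖x‖ ^ 2)
  have : Nonempty (Fin d) := ⟨⟨0, by omega⟩⟩
  have : Nontrivial (EuclideanSpace ℝ (Fin d)) := inferInstance
  have hne : ∀ᵐ x : EuclideanSpace ℝ (Fin d), x ≠ 0 := by
    rw [ae_iff]; simp
  have hNm : AEStronglyMeasurable N volume := by
    have := hu.continuous
    refine Measurable.aestronglyMeasurable ?_
    exact ((continuous_normSq.comp this).measurable.div (measurable_norm.pow_const 2)).const_mul _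
  have hN0 : ∀ x, 0 ≤ N x := fun x => by
    have := normSq_nonneg (u x)
    positivity
  have hNi : Integrable N := by
    refine (hB.const_mul (((d : ℝ) - 2) ^ 2 / 16)).mono' hNm (Eventually.of_forall fun x => ?_)
    rw [Real.norm_of_nonneg (hN0 x)]
    change ((d : ℝ) - 2) ^ 2 / 16 * (normSq (u x) / ‖x‖ ^ 2) ≤
      ((d : ℝ) - 2) ^ 2 / 16 * (∑ j, ‖pderiv j u x‖ + ‖u x‖ + ‖u x‖ / ‖x‖) ^ 2
    rw [normSq_eq_norm_sq, ← div_pow]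
    have : 0 ≤ ∑ j, ‖pderiv j u x‖ := Finset.sum_nonneg fun _ _ => norm_nonneg _
    have := norm_nonneg (u x)
    refine mul_le_mul_of_nonneg_left (pow_le_pow_left₀ (by positivity) ?_ 2) (by positivity)
    linarith
  set F := fun (n : ℕ) (i : Fin d) (x : EuclideanSpace ℝ (Fin d)) =>
    (cutoff n x : ℂ) * current k c b u i x with hF
  have hFc : ∀ n i, ContDiff ℝ 1 (F n i) := by
    intro n i
    refine contDiff_iff_contDiffAt.2 fun x => ?_
    by_cases hx : x = 0
    · subst hx
      refine contDiffAt_const (c := 0) |>.congr_of_eventuallyEq ?_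
      filter_upwards [cutoff_eventually_zero n] with y hy
      simp [hF, hy]
    · exact (ofRealCLM.contDiff.comp (contDiff_cutoff n)).contDiffAt.mul (contDiffAt_current hu hx i)
  have hFs : ∀ n i, HasCompactSupport (F n i) := by
    intro n i
    refine HasCompactSupport.mul_right ?_
    exact (hasCompactSupport_cutoff n).comp_left (g := ofReal) rfl
  have hFd : ∀ n i (x : EuclideanSpace ℝ (Fin d)), x ≠ 0 → pderiv i (F n i) x =
      (fderiv ℝ (cutoff n) x (EuclideanSpace.single i 1) : ℝ) * current k c b u i x +
      cutoff n x * pderiv i (current k c b u i) x := by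
    intro n i x hx
    have h1 := ofRealCLM.hasFDerivAt.comp x
      (((contDiff_cutoff n).differentiable one_ne_zero).differentiableAt (x := x)).hasFDerivAt
    have h2 := ((contDiffAt_current (k := k) (c := c) (b := b) hu hx i).differentiableAt
      one_ne_zero).hasFDerivAt
    have h3 : HasFDerivAt (F n i) _ x := h1.mul h2
    rw [pderiv, h3.fderiv]
    simp [pderiv]
    ring
  have hpt : ∀ n, ∀ᵐ x : EuclideanSpace ℝ (Fin d), cutoff n x * N x ≤
      G x - (∑ i, pderiv i (F n i) x).re + (d * (K * C)) / (n + 1) * B x := by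
    intro n
    filter_upwards [hne] with x hx
    have hr : 0 < ‖x‖ := norm_pos_iff.2 hx
    have h1 : cutoff n x * N x ≤
        cutoff n x * (G x - (∑ i, pderiv i (current k c b u i) x).re) :=
      mul_le_mul_of_nonneg_left (normSq_div_le_sub_div_current hd hk hu hx) (cutoff_nonneg n x)
    have h2 : cutoff n x * G x ≤ G x :=
      mul_le_of_le_one_left (mul_nonneg (by positivity) (normSq_nonneg _)) (cutoff_le_one n x)
    have h3 : (∑ i, pderiv i (F n i) x).re =
        (∑ i, (fderiv ℝ (cutoff n) x (EuclideanSpace.single i 1) : ℝ) * current k c b u i x).re +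
        cutoff n x * (∑ i, pderiv i (current k c b u i) x).re := by
      rw [Finset.sum_congr rfl fun i _ => hFd n i x hx, Finset.sum_add_distrib, ← Finset.mul_sum,
        add_re, re_ofReal_mul]
    have h4 : (∑ i, ((fderiv ℝ (cutoff n) x (EuclideanSpace.single i 1) : ℝ) : ℂ) *
        current k c b u i x).re ≤ (d * (K * C)) / (n + 1) * B x := by
      refine (re_le_norm _).trans ((norm_sum_le _ _).trans ?_)
      calc _ ≤ ∑ i : Fin d, K / ((n + 1) * ‖x‖) * (C * (‖x‖ * B x)) := by
            refine Finset.sum_le_sum fun i _ => ?_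
            rw [norm_mul, norm_real, Real.norm_eq_abs]
            exact mul_le_mul (hK n x hx i) (norm_current_le k c b u hx i) (norm_nonneg _)
              (by positivity)
        _ = _ := by
            rw [Finset.sum_const, Finset.card_univ, Fintype.card_fin, nsmul_eq_mul]
            field_simp
    rw [h3]
    rw [mul_sub] at h1
    linarith
  have hint : ∀ n, ∫ x, cutoff n x * N x ≤ (∫ x, G x) + (d * (K * C)) / (n + 1) * ∫ x, B x := by
    intro n
    have hD : Integrable fun x => ∑ i, pderiv i (F n i) x :=
      integrable_finsetSum _ fun i _ => (integral_pderiv_eq_zero (hFc n i) (hFs n i) i).1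
    -- The cut-off current is `C¹` with compact support even across the origin, so its divergence
    -- leaves no boundary term.
    have hD0 : ∫ x, (∑ i, pderiv i (F n i) x).re = 0 := by
      have := integral_re hD
      simp only [RCLike.re_to_complex] at this
      rw [this, integral_finsetSum _ fun i _ => (integral_pderiv_eq_zero (hFc n i) (hFs n i) i).1,
        Finset.sum_eq_zero fun i _ => (integral_pderiv_eq_zero (hFc n i) (hFs n i) i).2, zero_re]
    have hDr : Integrable fun x => (∑ i, pderiv i (F n i) x).re := hD.re
    have h1 : Integrable fun x => cutoff n x * N x := by
      refine hNi.bdd_mul (c := 1) (contDiff_cutoff n).continuous.aestronglyMeasurable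
        (Eventually.of_forall fun x => ?_)
      rw [Real.norm_of_nonneg (cutoff_nonneg n x)]
      exact cutoff_le_one n x
    refine (integral_mono_ae h1 ((hg.sub hDr).add (hB.const_mul _)) (hpt n)).trans_eq ?_
    rw [integral_add' (hg.sub hDr) (hB.const_mul _), integral_sub' hg hDr, hD0, sub_zero,
      integral_const_mul]
  have hlim : Tendsto (fun n => ∫ x, cutoff n x * N x) atTop (𝓝 (∫ x, N x)) := by
    refine tendsto_integral_of_dominated_convergence N
      (fun n => (contDiff_cutoff n).continuous.aestronglyMeasurable.mul hNm) hNi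
      (fun n => Eventually.of_forall fun x => ?_) ?_
    · rw [Real.norm_of_nonneg (mul_nonneg (cutoff_nonneg n x) (hN0 x))]
      exact mul_le_of_le_one_left (hN0 x) (cutoff_le_one n x)
    · filter_upwards [hne] with x hx
      simpa using (tendsto_cutoff hx).mul_const (N x)
  have hlim2 : Tendsto (fun n : ℕ => (∫ x, G x) + (d * (K * C)) / ((n : ℝ) + 1) * ∫ x, B x) atTop
      (𝓝 ((∫ x, G x) + 0 * ∫ x, B x)) :=
    tendsto_const_nhds.add ((tendsto_const_nhds.div_atTop
      (tendsto_atTop_add_const_right _ _ tendsto_natCast_atTop_atTop)).mul_const _)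
  rw [zero_mul, add_zero] at hlim2
  exact le_of_tendsto_of_tendsto' hlim hlim2 hint

/-! ### The Fourier symbol and the resolvent set -/

/-- The Fourier symbol of `-Δ - z`. -/
def symbol (d : ℕ) (z : ℂ) (ξ : EuclideanSpace ℝ (Fin d)) : ℂ :=
  (((2 * Real.pi) ^ 2 : ℝ) : ℂ) * ofReal (‖ξ‖ ^ 2) - z

theorem hasTemperateGrowth_symbol (z : ℂ) : (symbol d z).HasTemperateGrowth := by
  unfold symbol
  fun_prop

/-- A function that is smooth on an open neighbourhood of `[0, 1]` agrees there with a smooth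
compactly supported function. -/
theorem exists_contDiff_compactSupport_eqOn {h : ℝ → ℂ} {U : Set ℝ} (hU : IsOpen U)
    (hIU : Set.Icc 0 1 ⊆ U) (hh : ContDiffOn ℝ (↑(⊤ : ℕ∞)) h U) :
    ∃ H : ℝ → ℂ, ContDiff ℝ (↑(⊤ : ℕ∞)) H ∧ HasCompactSupport H ∧ ∀ t ∈ Set.Icc (0 : ℝ) 1, H t = h t := by
  obtain ⟨δ, hδ, hδU⟩ := isCompact_Icc.exists_cthickening_subset_open hU hIU
  let χ : ContDiffBump (1 / 2 : ℝ) := ⟨1 / 2, 1 / 2 + δ, by norm_num, by linarith⟩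
  have hχU : tsupport χ ⊆ U := by
    rw [χ.tsupport_eq]
    refine Set.Subset.trans (fun t ht => ?_) hδU
    rw [mem_closedBall_iff_norm, Real.norm_eq_abs] at ht
    change |t - 1 / 2| ≤ 1 / 2 + δ at ht
    rw [abs_le] at ht
    -- The witness is the projection of `t` onto `[0, 1]`.
    refine Metric.mem_cthickening_of_dist_le t (max 0 (min t 1)) δ _
      ⟨le_max_left _ _, max_le zero_le_one (min_le_right _ _)⟩ ?_
    rw [Real.dist_eq, abs_le]
    rcases le_total t 1 with h1 | h1 <;> rcases le_total 0 t with h2 | h2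
    · rw [min_eq_left h1, max_eq_right h2]; constructor <;> linarith
    · rw [min_eq_left h1, max_eq_left h2]; constructor <;> linarith
    · rw [min_eq_right h1, max_eq_right zero_le_one]; constructor <;> linarith
    · linarith
  refine ⟨fun t => (χ t : ℂ) * h t, contDiff_iff_contDiffAt.2 fun t => ?_, ?_, fun t ht => ?_⟩
  · by_cases ht : t ∈ tsupport χ
    · exact (ofRealCLM.contDiff.comp χ.contDiff).contDiffAt.mul
        (hh.contDiffAt (hU.mem_nhds (hχU ht)))
    · refine (contDiffAt_const (c := 0)).congr_of_eventuallyEq ?_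
      filter_upwards [notMem_tsupport_iff_eventuallyEq.1 ht] with s hs
      rw [hs]; simp
  · exact (χ.hasCompactSupport.comp_left (g := ofReal) rfl).mul_right
  · have : χ t = 1 := by
      refine χ.one_of_mem_closedBall ?_
      rw [mem_closedBall_iff_norm, Real.norm_eq_abs, abs_le]
      change -(1 / 2) ≤ t - 1 / 2 ∧ t - 1 / 2 ≤ 1 / 2
      constructor <;> linarith [ht.1, ht.2]
    simp [this]

theorem symbol_ne_zero {z : ℂ} (hz : z ∉ ofReal '' Set.Ici (0 : ℝ)) (ξ : EuclideanSpace ℝ (Fin d)) :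
    symbol d z ξ ≠ 0 := by
  intro h
  refine hz ⟨(2 * Real.pi) ^ 2 * ‖ξ‖ ^ 2, Set.mem_Ici.2 (by positivity), ?_⟩
  rw [symbol, sub_eq_zero] at h
  rw [← h]
  push_cast
  ring

/-- The inverse of the symbol of `-Δ - z` decays like `(1 + |ξ|²)⁻¹`, as a symbol. -/
theorem exists_inv_symbol_eq {z : ℂ} (hz : z ∉ ofReal '' Set.Ici (0 : ℝ)) :
    ∃ H : EuclideanSpace ℝ (Fin d) → ℂ, H.HasTemperateGrowth ∧ (∃ C, ∀ ξ, ‖H ξ‖ ≤ C) ∧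
      ∀ ξ, (symbol d z ξ)⁻¹ = ((1 + ‖ξ‖ ^ 2) ^ (-1 : ℝ) : ℝ) * H ξ := by
  set a : ℝ := (2 * Real.pi) ^ 2 with ha
  have ha0 : 0 < a := by positivity
  -- With `w = (1 + |ξ|²)⁻¹ ∈ (0, 1]` the symbol is `D w / w`. The endpoint `w = 0` stands for `|ξ|
  -- = ∞`, where `D = a ≠ 0`; a zero in `(0, 1]` would give `z = a/w - a ≥ 0`. So `1/D` is smooth
  -- near `[0, 1]`.
  set D : ℝ → ℂ := fun w => (a : ℂ) - (a + z) * w with hD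
  have hDs : ContDiff ℝ (↑(⊤ : ℕ∞)) D :=
    contDiff_const.sub (contDiff_const.mul ofRealCLM.contDiff)
  have hDne : ∀ w ∈ Set.Icc (0 : ℝ) 1, D w ≠ 0 := by
    rintro w ⟨h0, h1⟩ h
    rcases h0.eq_or_lt with rfl | h0
    · simp [hD, ha0.ne'] at h
    refine hz ⟨a / w - a, ?_, ?_⟩
    · rw [Set.mem_Ici, sub_nonneg, le_div_iff₀ h0]
      nlinarith
    · have hw : (w : ℂ) ≠ 0 := by exact_mod_cast h0.ne'
      rw [hD] at h
      simp only at h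
      push_cast
      field_simp
      linear_combination h
  obtain ⟨H, hHs, hHc, hH⟩ := exists_contDiff_compactSupport_eqOn (U := {w | D w ≠ 0})
    (h := fun w => (D w)⁻¹) (isOpen_ne.preimage hDs.continuous) hDne
    (fun w hw => (hDs.contDiffAt.inv hw).contDiffWithinAt)
  obtain ⟨C, hC⟩ := hHs.continuous.bounded_above_of_compact_support hHc
  refine ⟨fun ξ => H ((1 + ‖ξ‖ ^ 2) ^ (-1 : ℝ)), (hHc.hasTemperateGrowth hHs).comp
    (Function.hasTemperateGrowth_one_add_norm_sq_rpow _ (-1)), ⟨C, fun ξ => hC _⟩, fun ξ => ?_⟩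
  have h1 : (0 : ℝ) < 1 + ‖ξ‖ ^ 2 := by positivity
  have h1' : (1 + (‖ξ‖ : ℂ) ^ 2) ≠ 0 := by exact_mod_cast h1.ne'
  simp only [Real.rpow_neg_one]
  rw [hH _ ⟨by positivity, inv_le_one_of_one_le₀ (by nlinarith [sq_nonneg ‖ξ‖])⟩]
  have h2 : D (1 + ‖ξ‖ ^ 2)⁻¹ = symbol d z ξ * (1 + (‖ξ‖ : ℂ) ^ 2)⁻¹ := by
    simp only [hD, symbol, ← ha]
    push_cast
    field_simp
    ring
  rw [h2]
  have := symbol_ne_zero hz ξ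
  push_cast
  field_simp

theorem hasTemperateGrowth_inv_symbol {z : ℂ} (hz : z ∉ ofReal '' Set.Ici (0 : ℝ)) :
    (fun ξ => (symbol d z ξ)⁻¹).HasTemperateGrowth := by
  obtain ⟨H, hH, -, h⟩ := exists_inv_symbol_eq (d := d) hz
  simp only [h]
  fun_prop

theorem exists_norm_inv_symbol_le {z : ℂ} (hz : z ∉ ofReal '' Set.Ici (0 : ℝ)) :
    ∃ C, ∀ ξ, ‖(symbol d z ξ)⁻¹‖ ≤ C := by
  obtain ⟨H, -, ⟨C, hC⟩, h⟩ := exists_inv_symbol_eq (d := d) hz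
  refine ⟨C, fun ξ => ?_⟩
  rw [h, norm_mul, norm_real, Real.norm_of_nonneg (by positivity)]
  refine (mul_le_of_le_one_left (norm_nonneg _) ?_).trans (hC ξ)
  exact Real.rpow_le_one_of_one_le_of_nonpos (by nlinarith [sq_nonneg ‖ξ‖]) (by norm_num)

theorem fourierMultiplierCLM_symbol (z : ℂ) (f : 𝓢'(EuclideanSpace ℝ (Fin d), ℂ)) :
    fourierMultiplierCLM ℂ (symbol d z) f = -Δ f - z • f := by
  have h1 : (fun ξ : EuclideanSpace ℝ (Fin d) =>
      (((2 * Real.pi) ^ 2 : ℝ) : ℂ) * ofReal (‖ξ‖ ^ 2)).HasTemperateGrowth := by fun_prop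
  have h2 : (fun _ : EuclideanSpace ℝ (Fin d) => z).HasTemperateGrowth := by fun_prop
  have h3 : (fun ξ : EuclideanSpace ℝ (Fin d) => ofReal (‖ξ‖ ^ 2)).HasTemperateGrowth := by fun_prop
  have e : symbol d z = (fun ξ : EuclideanSpace ℝ (Fin d) =>
      (((2 * Real.pi) ^ 2 : ℝ) : ℂ) * ofReal (‖ξ‖ ^ 2)) - fun _ => z := rfl
  have e2 : (fun ξ : EuclideanSpace ℝ (Fin d) =>
      (((2 * Real.pi) ^ 2 : ℝ) : ℂ) * ofReal (‖ξ‖ ^ 2)) =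
      (((2 * Real.pi) ^ 2 : ℝ) : ℂ) • fun ξ : EuclideanSpace ℝ (Fin d) => ofReal (‖ξ‖ ^ 2) := rfl
  have e3 : fourierMultiplierCLM ℂ (symbol d z) f = fourierMultiplierCLM ℂ
      (fun ξ : EuclideanSpace ℝ (Fin d) => (((2 * Real.pi) ^ 2 : ℝ) : ℂ) * ofReal (‖ξ‖ ^ 2)) f -
      fourierMultiplierCLM ℂ (fun _ => z) f := by
    ext u
    rw [_root_.sub_apply]
    simp only [fourierMultiplierCLM_apply_apply]
    rw [e, SchwartzMap.smulLeftCLM_sub h1 h2, _root_.sub_apply, sub_eq_add_neg,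
      FourierTransform.fourier_add, FourierTransform.fourier_neg, map_add, map_neg,
      ← sub_eq_add_neg]
  rw [e3, e2, fourierMultiplierCLM_smul h3, fourierMultiplierCLM_const, laplacian_eq_fourierMultiplierCLM]
  simp only [neg_smul, neg_neg, _root_.smul_apply, ContinuousLinearMap.id_apply]
  congr 1

/-- A bounded symbol of temperate growth acts boundedly on `L²`. -/
theorem exists_L2_fourierMultiplierCLM {m : EuclideanSpace ℝ (Fin d) → ℂ} (hm : m.HasTemperateGrowth)
    {C : ℝ} (hC : ∀ ξ, ‖m ξ‖ ≤ C) : ∃ K : ℝ, ∀ g : L2Space d, ∃ f : L2Space d,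
      (f : 𝓢'(EuclideanSpace ℝ (Fin d), ℂ)) = fourierMultiplierCLM ℂ m g ∧ ‖f‖ ≤ K * ‖g‖ := by
  have hm' : MemLp m ∞ (volume : Measure (EuclideanSpace ℝ (Fin d))) :=
    memLp_top_of_bound hm.1.continuous.aestronglyMeasurable C (Eventually.of_forall hC)
  refine ⟨‖hm'.toLp m‖, fun g => ⟨𝓕⁻ ((hm'.toLp m) • (𝓕 g) : L2Space d), ?_, ?_⟩⟩
  · rw [← Lp.fourierInv_toTemperedDistribution_eq, Lp.toTemperedDistribution_smul_eq hm,
      fourierMultiplierCLM_apply, Lp.fourier_toTemperedDistribution_eq]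
  · rw [← Lp.norm_fourier_eq, fourier_fourierInv_eq]
    refine (Lp.norm_smul_le _ _).trans_eq ?_
    rw [Lp.norm_fourier_eq]

/-- The Bessel weight `1 + |ξ|²` cancels the decay of the inverse symbol exactly and leaves a
bounded multiplier, so two derivatives are gained. The constant `K` depends on `z`. -/
theorem exists_sobolevTwo_resolvent {z : ℂ} (hz : z ∉ ofReal '' Set.Ici (0 : ℝ)) :
    ∃ K : ℝ, ∀ g : L2Space d, ∃ f : L2Space d, f ∈ sobolevTwo d ∧
      (f : 𝓢'(EuclideanSpace ℝ (Fin d), ℂ)) =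
        fourierMultiplierCLM ℂ (fun ξ => (symbol d z ξ)⁻¹) g ∧ ‖f‖ ≤ K * ‖g‖ := by
  have hm := hasTemperateGrowth_inv_symbol (d := d) hz
  obtain ⟨C, hC⟩ := exists_norm_inv_symbol_le (d := d) hz
  obtain ⟨H, hH, hHb, hmH⟩ := exists_inv_symbol_eq (d := d) hz
  obtain ⟨K, hK⟩ := exists_L2_fourierMultiplierCLM hm hC
  refine ⟨K, fun g => ?_⟩
  obtain ⟨f, hf, hfK⟩ := hK g
  refine ⟨f, ?_, hf, hfK⟩
  change MemSobolev 2 2 (f : 𝓢'(EuclideanSpace ℝ (Fin d), ℂ))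
  have hg : MemSobolev 0 2 (g : 𝓢'(EuclideanSpace ℝ (Fin d), ℂ)) := memSobolev_zero_iff.2 ⟨g, rfl⟩
  have h := hg.fourierMultiplierCLM_of_bounded hH hHb
  rw [← add_zero (2 : ℝ), ← memSobolev_besselPotential_iff, hf, besselPotential,
    fourierMultiplierCLM_fourierMultiplierCLM_apply hm (by fun_prop)]
  have e : ((fun ξ => (symbol d z ξ)⁻¹) * fun ξ : EuclideanSpace ℝ (Fin d) =>
      (((1 + ‖ξ‖ ^ 2) ^ ((2 : ℝ) / 2) : ℝ) : ℂ)) = H := by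
    ext ξ
    have h1 : (0 : ℝ) < 1 + ‖ξ‖ ^ 2 := by positivity
    have h2 : (((1 + ‖ξ‖ ^ 2 : ℝ)) : ℂ) ≠ 0 := by exact_mod_cast h1.ne'
    rw [Pi.mul_apply, hmH, Real.rpow_neg_one, show (2 : ℝ) / 2 = 1 by norm_num, Real.rpow_one,
      ofReal_inv]
    field_simp
  rw [e]
  exact h

theorem shift_toTemperedDistribution (z : ℂ)
    (ψ : (UnboundedOperator.shift (freeHamiltonian d) z).domain) :
    ((UnboundedOperator.shift (freeHamiltonian d) z ψ : L2Space d) :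
      𝓢'(EuclideanSpace ℝ (Fin d), ℂ)) =
      fourierMultiplierCLM ℂ (symbol d z) ((ψ : L2Space d) : 𝓢'(EuclideanSpace ℝ (Fin d), ℂ)) := by
  obtain ⟨ψ, hψ⟩ := ψ
  have hψ' : ψ ∈ (freeHamiltonian d).domain := hψ
  have h : UnboundedOperator.shift (freeHamiltonian d) z ⟨ψ, hψ⟩ =
      -(z • ψ) + freeHamiltonian d ⟨ψ, hψ'⟩ := rfl
  rw [h, fourierMultiplierCLM_symbol, ← Lp.toTemperedDistributionCLM_apply, map_add, map_neg,
    map_smul, Lp.toTemperedDistributionCLM_apply, Lp.toTemperedDistributionCLM_apply,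
    freeHamiltonian_apply]
  abel

theorem fourierMultiplierCLM_inv_symbol_symbol {z : ℂ} (hz : z ∉ ofReal '' Set.Ici (0 : ℝ))
    (f : 𝓢'(EuclideanSpace ℝ (Fin d), ℂ)) :
    fourierMultiplierCLM ℂ (fun ξ => (symbol d z ξ)⁻¹) (fourierMultiplierCLM ℂ (symbol d z) f) = f := by
  rw [fourierMultiplierCLM_fourierMultiplierCLM_apply (hasTemperateGrowth_symbol z)
    (hasTemperateGrowth_inv_symbol hz)]
  have : (symbol d z * fun ξ => (symbol d z ξ)⁻¹) = fun _ => 1 := by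
    ext ξ
    exact mul_inv_cancel₀ (symbol_ne_zero hz ξ)
  rw [this, fourierMultiplierCLM_const]
  simp

theorem fourierMultiplierCLM_symbol_inv_symbol {z : ℂ} (hz : z ∉ ofReal '' Set.Ici (0 : ℝ))
    (f : 𝓢'(EuclideanSpace ℝ (Fin d), ℂ)) :
    fourierMultiplierCLM ℂ (symbol d z) (fourierMultiplierCLM ℂ (fun ξ => (symbol d z ξ)⁻¹) f) = f := by
  rw [fourierMultiplierCLM_fourierMultiplierCLM_apply (hasTemperateGrowth_inv_symbol hz)
    (hasTemperateGrowth_symbol z)]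
  have : ((fun ξ => (symbol d z ξ)⁻¹) * symbol d z) = fun _ => 1 := by
    ext ξ
    exact inv_mul_cancel₀ (symbol_ne_zero hz ξ)
  rw [this, fourierMultiplierCLM_const]
  simp

theorem shift_eq_iff {z : ℂ} (hz : z ∉ ofReal '' Set.Ici (0 : ℝ)) (g : L2Space d)
    (ψ : (UnboundedOperator.shift (freeHamiltonian d) z).domain) :
    UnboundedOperator.shift (freeHamiltonian d) z ψ = g ↔
      ((ψ : L2Space d) : 𝓢'(EuclideanSpace ℝ (Fin d), ℂ)) =
        fourierMultiplierCLM ℂ (fun ξ => (symbol d z ξ)⁻¹) g := by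
  constructor
  · rintro rfl
    rw [shift_toTemperedDistribution, fourierMultiplierCLM_inv_symbol_symbol hz]
  · intro h
    apply L2Space.ext_distribution
    rw [shift_toTemperedDistribution, h, fourierMultiplierCLM_symbol_inv_symbol hz]

theorem bijective_shift {z : ℂ} (hz : z ∉ ofReal '' Set.Ici (0 : ℝ)) :
    Function.Bijective (UnboundedOperator.shift (freeHamiltonian d) z) := by
  obtain ⟨K, hK⟩ := exists_sobolevTwo_resolvent (d := d) hz
  refine ⟨fun ψ φ h => ?_, fun g => ?_⟩
  · apply Subtype.ext
    apply L2Space.ext_distribution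
    rw [(shift_eq_iff hz _ ψ).1 rfl, (shift_eq_iff hz _ φ).1 rfl, h]
  · obtain ⟨f, hf, hfg, -⟩ := hK g
    exact ⟨⟨f, hf⟩, (shift_eq_iff hz g ⟨f, hf⟩).2 hfg⟩

theorem mem_resolventSet {z : ℂ} (hz : z ∉ ofReal '' Set.Ici (0 : ℝ)) :
    z ∈ UnboundedOperator.resolventSet (freeHamiltonian d) := by
  obtain ⟨K, hK⟩ := exists_sobolevTwo_resolvent (d := d) hz
  refine ⟨bijective_shift hz, K, fun ψ => ?_⟩
  obtain ⟨f, hf, hfg, hfK⟩ := hK (UnboundedOperator.shift (freeHamiltonian d) z ψ)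
  rwa [L2Space.ext_distribution (((shift_eq_iff hz _ ψ).1 rfl).trans hfg.symm)]

/-! ### Schwartz functions in `L²` and the points of the spectrum -/

/-- A Schwartz function as an element of `L²`. -/
def schwartzL2 (f : 𝓢(EuclideanSpace ℝ (Fin d), ℂ)) : L2Space d := f.toLp 2 volume

theorem coeFn_schwartzL2 (f : 𝓢(EuclideanSpace ℝ (Fin d), ℂ)) : schwartzL2 f =ᵐ[volume] f :=
  f.coeFn_toLp 2 volume

theorem schwartzL2_toTemperedDistribution (f : 𝓢(EuclideanSpace ℝ (Fin d), ℂ)) :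
    (schwartzL2 f : 𝓢'(EuclideanSpace ℝ (Fin d), ℂ)) =
      SchwartzMap.toTemperedDistributionCLM _ ℂ volume f :=
  Lp.toTemperedDistribution_toLp_eq f

theorem schwartzL2_injective :
    Function.Injective (schwartzL2 : 𝓢(EuclideanSpace ℝ (Fin d), ℂ) → L2Space d) :=
  SchwartzMap.injective_toLp 2 volume

theorem schwartzL2_zero : schwartzL2 (0 : 𝓢(EuclideanSpace ℝ (Fin d), ℂ)) = 0 :=
  map_zero (SchwartzMap.toLpCLM ℝ ℂ 2 volume)

theorem fourierInv_schwartzL2 (f : 𝓢(EuclideanSpace ℝ (Fin d), ℂ)) :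
    𝓕⁻ (schwartzL2 f) = schwartzL2 (𝓕⁻ f) :=
  SchwartzMap.toLp_fourierInv_eq f

theorem norm_schwartzL2_fourierInv (f : 𝓢(EuclideanSpace ℝ (Fin d), ℂ)) :
    ‖schwartzL2 (𝓕⁻ f)‖ = ‖schwartzL2 f‖ := by
  rw [← fourierInv_schwartzL2, ← Lp.norm_fourier_eq, fourier_fourierInv_eq]

/-- Schwartz functions are in the domain of the free Hamiltonian. -/
theorem schwartzL2_mem_sobolevTwo (f : 𝓢(EuclideanSpace ℝ (Fin d), ℂ)) :
    schwartzL2 f ∈ sobolevTwo d := by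
  change MemSobolev 2 2 (schwartzL2 f : 𝓢'(EuclideanSpace ℝ (Fin d), ℂ))
  rw [schwartzL2_toTemperedDistribution]
  exact f.memSobolev

theorem shift_schwartzL2 (z : ℂ) (f : 𝓢(EuclideanSpace ℝ (Fin d), ℂ)) :
    UnboundedOperator.shift (freeHamiltonian d) z ⟨schwartzL2 f, schwartzL2_mem_sobolevTwo f⟩ =
      schwartzL2 (SchwartzMap.fourierMultiplierCLM ℂ (symbol d z) f) := by
  apply L2Space.ext_distribution
  rw [shift_toTemperedDistribution, schwartzL2_toTemperedDistribution,
    schwartzL2_toTemperedDistribution, fourierMultiplierCLM_toTemperedDistributionCLM_eq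
      (hasTemperateGrowth_symbol _)]

/-- Approximate eigenfunctions: inverse Fourier transforms of bumps around a point of the sphere
`4π²|ξ|² = t`, where the symbol vanishes. -/
theorem notMem_resolventSet (hd : 0 < d) {t : ℝ} (ht : 0 ≤ t) :
    (t : ℂ) ∉ UnboundedOperator.resolventSet (freeHamiltonian d) := by
  rintro ⟨-, K, hK⟩
  set ξ₀ : EuclideanSpace ℝ (Fin d) := EuclideanSpace.single ⟨0, hd⟩ (√t / (2 * Real.pi)) with hξ
  have h0 : symbol d t ξ₀ = 0 := by
    have : (2 * Real.pi) ^ 2 * ‖ξ₀‖ ^ 2 = t := by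
      rw [hξ, PiLp.norm_single, Real.norm_of_nonneg (by positivity), ← mul_pow,
        mul_div_cancel₀ _ (by positivity), Real.sq_sqrt ht]
    rw [symbol, sub_eq_zero, ← ofReal_mul, this]
  have hc : Tendsto (fun ξ => ‖symbol d t ξ‖) (𝓝 ξ₀) (𝓝 0) := by
    have := ((hasTemperateGrowth_symbol (d := d) (t : ℂ)).1.continuous.norm).tendsto ξ₀
    rwa [h0, norm_zero] at this
  -- With the symbol this small on the support of the bump, the resolvent bound would give `‖φ‖ ≤
  -- ‖φ‖ / 2`.
  have hε : (0 : ℝ) < 1 / (2 * (|K| + 1)) := by positivity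
  obtain ⟨δ, hδ, hball⟩ := Metric.eventually_nhds_iff_ball.1 (hc.eventually (gt_mem_nhds hε))
  let χ : ContDiffBump ξ₀ := ⟨δ / 2, δ, by linarith, by linarith⟩
  have hχc : HasCompactSupport fun ξ => (χ ξ : ℂ) := χ.hasCompactSupport.comp_left (g := ofReal) rfl
  have hχs : ContDiff ℝ (↑(⊤ : ℕ∞)) fun ξ => (χ ξ : ℂ) := ofRealCLM.contDiff.comp χ.contDiff
  set φ : 𝓢(EuclideanSpace ℝ (Fin d), ℂ) := hχc.toSchwartzMap hχs
  have hφv : ∀ ξ, φ ξ = (χ ξ : ℂ) := fun ξ => rfl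
  have hne : 0 < ‖schwartzL2 φ‖ := by
    rw [norm_pos_iff]
    intro h
    have h2 : φ = 0 := schwartzL2_injective (h.trans schwartzL2_zero.symm)
    have h3 : φ ξ₀ = 0 := by rw [h2]; rfl
    rw [hφv, χ.one_of_mem_closedBall (Metric.mem_closedBall_self (by positivity))] at h3
    simp at h3
  have h := hK ⟨schwartzL2 (𝓕⁻ φ), schwartzL2_mem_sobolevTwo _⟩
  rw [shift_schwartzL2, SchwartzMap.fourierMultiplierCLM_apply, fourier_fourierInv_eq,
    norm_schwartzL2_fourierInv] at h
  rw [norm_schwartzL2_fourierInv] at h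
  have hle : ‖schwartzL2 (SchwartzMap.smulLeftCLM ℂ (symbol d t) φ)‖ ≤
      1 / (2 * (|K| + 1)) * ‖schwartzL2 φ‖ := by
    refine Lp.norm_le_mul_norm_of_ae_le_mul ?_
    filter_upwards [coeFn_schwartzL2 (SchwartzMap.smulLeftCLM ℂ (symbol d t) φ),
      coeFn_schwartzL2 φ] with ξ h1 h2
    rw [h1, h2, SchwartzMap.smulLeftCLM_apply_apply (hasTemperateGrowth_symbol _), norm_smul]
    by_cases hξ : ξ ∈ Metric.ball ξ₀ δ
    · exact mul_le_mul_of_nonneg_right (hball ξ hξ).le (norm_nonneg _)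
    · have : φ ξ = 0 := by
        rw [hφv, χ.zero_of_le_dist (by simpa using hξ), ofReal_zero]
      rw [this, norm_zero, mul_zero, mul_zero]
  have h2 : K * ‖schwartzL2 (SchwartzMap.smulLeftCLM ℂ (symbol d t) φ)‖ ≤
      (|K| + 1) * (1 / (2 * (|K| + 1)) * ‖schwartzL2 φ‖) :=
    mul_le_mul (by linarith [le_abs_self K]) hle (norm_nonneg _) (by positivity)
  have h3 : (|K| + 1) * (1 / (2 * (|K| + 1)) * ‖schwartzL2 φ‖) =
      ‖schwartzL2 φ‖ / 2 := by
    field_simp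
  linarith

theorem spectrum_freeHamiltonian (hd : 0 < d) :
    UnboundedOperator.spectrum (freeHamiltonian d) = ofReal '' Set.Ici (0 : ℝ) := by
  ext z
  rw [UnboundedOperator.spectrum, Set.mem_compl_iff]
  constructor
  · intro h
    by_contra hz
    exact h (mem_resolventSet hz)
  · rintro ⟨t, ht, rfl⟩
    exact notMem_resolventSet hd ht

/-! ### The weighted estimate for Schwartz data -/

theorem schwartz_helmholtz {z : ℂ} (hz : z ∉ ofReal '' Set.Ici (0 : ℝ))
    (g : 𝓢(EuclideanSpace ℝ (Fin d), ℂ)) :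
    -Δ (SchwartzMap.fourierMultiplierCLM ℂ (fun ξ => (symbol d z ξ)⁻¹) g) -
      z • SchwartzMap.fourierMultiplierCLM ℂ (fun ξ => (symbol d z ξ)⁻¹) g = g := by
  apply schwartzL2_injective
  apply L2Space.ext_distribution
  rw [schwartzL2_toTemperedDistribution, schwartzL2_toTemperedDistribution, map_sub, map_neg,
    map_smul, ← laplacian_toTemperedDistributionCLM_eq,
    ← fourierMultiplierCLM_toTemperedDistributionCLM_eq (hasTemperateGrowth_inv_symbol hz),
    ← fourierMultiplierCLM_symbol, fourierMultiplierCLM_symbol_inv_symbol hz]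

theorem laplacian_eq_sum_pderiv (u : 𝓢(EuclideanSpace ℝ (Fin d), ℂ)) (x : EuclideanSpace ℝ (Fin d)) :
    (Δ u) x = ∑ i, pderiv i (pderiv i u) x := by
  rw [SchwartzMap.laplacian_eq_sum (EuclideanSpace.basisFun (Fin d) ℝ), _root_.sum_apply]
  refine Finset.sum_congr rfl fun i _ => ?_
  rw [EuclideanSpace.basisFun_apply]
  rfl

/-- For `d ≥ 3` the weight `|x|⁻²` is integrable on the unit ball, where `u` is bounded; outside the
ball the weight is at most `1`. -/
theorem memLp_norm_div (hd : 3 ≤ d) (u : 𝓢(EuclideanSpace ℝ (Fin d), ℂ)) :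
    MemLp (fun x => ‖u x‖ / ‖x‖) 2 volume := by
  have hm : AEStronglyMeasurable (fun x : EuclideanSpace ℝ (Fin d) => ‖u x‖ / ‖x‖) volume :=
    (u.continuous.norm.measurable.div measurable_norm).aestronglyMeasurable
  rw [memLp_two_iff_integrable_sq hm]
  have hu2 : Integrable (fun x => ‖u x‖ ^ 2) volume :=
    (memLp_two_iff_integrable_sq_norm u.continuous.aestronglyMeasurable).1 (u.memLp 2 volume)
  obtain ⟨C, hC⟩ : ∃ C, ∀ x, ‖u x‖ ≤ C := ⟨_, fun x => u.norm_le_seminorm ℝ x⟩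
  have hC0 : 0 ≤ C := (norm_nonneg _).trans (hC 0)
  have h1 : IntegrableOn (fun x => (‖u x‖ / ‖x‖) ^ 2) (Metric.ball 0 1) volume := by
    refine integrableOn_ball_of_norm_le_rpow (C := C ^ 2) (α := 2) ?_ ?_
      (Eventually.of_forall fun x => ?_) (hm.pow 2)
    · rw [finrank_euclideanSpace_fin]; omega
    · rw [finrank_euclideanSpace_fin]; exact_mod_cast hd
    · rw [Real.norm_of_nonneg (by positivity), Real.rpow_neg (norm_nonneg _), Real.rpow_two, div_pow,
        div_eq_mul_inv]
      gcongr
      exact hC x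
  have h2 : IntegrableOn (fun x => (‖u x‖ / ‖x‖) ^ 2) (Metric.ball 0 1)ᶜ volume := by
    refine hu2.integrableOn.mono' (hm.pow 2).restrict ?_
    filter_upwards [ae_restrict_mem Metric.isOpen_ball.measurableSet.compl] with x hx
    rw [Set.mem_compl_iff, mem_ball_zero_iff, not_lt] at hx
    rw [Real.norm_of_nonneg (by positivity)]
    gcongr
    exact div_le_self (norm_nonneg _) hx
  rw [← integrableOn_univ, ← Set.union_compl_self (Metric.ball (0 : EuclideanSpace ℝ (Fin d)) 1)]
  exact h1.union h2

theorem memLp_norm_mul (u : 𝓢(EuclideanSpace ℝ (Fin d), ℂ)) :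
    MemLp (fun x => ‖x‖ * ‖u x‖) 2 volume := by
  have h : (fun x : EuclideanSpace ℝ (Fin d) => 1 + ‖x‖ ^ 2).HasTemperateGrowth := by fun_prop
  refine ((SchwartzMap.smulLeftCLM ℂ (fun x : EuclideanSpace ℝ (Fin d) => 1 + ‖x‖ ^ 2) u).memLp 2
    volume).of_le (continuous_norm.mul u.continuous.norm).aestronglyMeasurable
    (Eventually.of_forall fun x => ?_)
  rw [SchwartzMap.smulLeftCLM_apply_apply h, norm_smul, Real.norm_of_nonneg (by positivity),
    Real.norm_of_nonneg (by positivity)]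
  gcongr
  nlinarith [sq_nonneg (‖x‖ - 1), norm_nonneg x]

/-- This branch makes `e^{ik|x|}` bounded and gives the terms with `Im k` in the multiplier
inequality their sign. -/
theorem exists_sq_eq_im_nonneg (z : ℂ) : ∃ k : ℂ, 0 ≤ k.im ∧ k ^ 2 = z := by
  obtain ⟨k, hk⟩ := IsAlgClosed.exists_pow_nat_eq z (n := 2) two_pos
  rcases le_total 0 k.im with h | h
  · exact ⟨k, h, hk⟩
  · exact ⟨-k, by simpa using h, by rw [neg_sq, hk]⟩

/-- The weighted resolvent estimate for Schwartz data. -/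
theorem eLpNorm_resolvent_schwartz_le (hd : 3 ≤ d) {z : ℂ} (hz : z ∉ ofReal '' Set.Ici (0 : ℝ))
    (g : 𝓢(EuclideanSpace ℝ (Fin d), ℂ)) :
    eLpNorm (fun x => ‖x‖⁻¹ • SchwartzMap.fourierMultiplierCLM ℂ (fun ξ => (symbol d z ξ)⁻¹) g x) 2
      volume ≤ ENNReal.ofReal (4 / ((d : ℝ) - 2)) *
        eLpNorm (fun x => ‖x‖ • g x) 2 volume := by
  -- Off the spectrum the inverse symbol has temperate growth, so `u` is again Schwartz and all
  -- integrability hypotheses hold. This qualitative input does not enter the constant.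
  set u := SchwartzMap.fourierMultiplierCLM ℂ (fun ξ => (symbol d z ξ)⁻¹) g
  obtain ⟨k, hk, rfl⟩ := exists_sq_eq_im_nonneg z
  have hd2 : (0 : ℝ) < (d : ℝ) - 2 := by
    have : (3 : ℝ) ≤ d := by exact_mod_cast hd
    linarith
  have hg : ∀ x, -∑ i, pderiv i (pderiv i u) x - k ^ 2 * u x = g x := by
    intro x
    rw [← laplacian_eq_sum_pderiv]
    conv_rhs => rw [← schwartz_helmholtz hz g]
    rfl
  have hB : MemLp (fun x => ∑ j, ‖pderiv j u x‖ + ‖u x‖ + ‖u x‖ / ‖x‖) 2 volume := by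
    refine ((memLp_finsetSum _ fun j _ => ?_).add (u.memLp 2 volume).norm).add (memLp_norm_div hd u)
    exact ((∂_{EuclideanSpace.single j (1 : ℝ)} u).memLp 2 volume).norm
  have hN := memLp_norm_div hd u
  have hG := memLp_norm_mul g
  have key := integral_normSq_div_le hd hk (u.smooth 2) hB.integrable_sq (by
    simp only [hg]
    refine hG.integrable_sq.congr (Eventually.of_forall fun x => ?_)
    simp only [normSq_eq_norm_sq, mul_pow])
  simp only [hg] at key
  have e1 : eLpNorm (fun x => ‖x‖⁻¹ • u x) 2 volume = eLpNorm (fun x => ‖u x‖ / ‖x‖) 2 volume := by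
    refine eLpNorm_congr_norm_ae (Eventually.of_forall fun x => ?_)
    rw [norm_smul, norm_inv, norm_norm, norm_div, norm_norm, norm_norm]
    ring
  have e2 : eLpNorm (fun x => ‖x‖ • g x) 2 volume = eLpNorm (fun x => ‖x‖ * ‖g x‖) 2 volume := by
    refine eLpNorm_congr_norm_ae (Eventually.of_forall fun x => ?_)
    rw [norm_smul, norm_mul, norm_norm, norm_norm]
  rw [e1, e2, hN.eLpNorm_eq_integral_rpow_norm two_ne_zero ENNReal.ofNat_ne_top,
    hG.eLpNorm_eq_integral_rpow_norm two_ne_zero ENNReal.ofNat_ne_top,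
    ← ENNReal.ofReal_mul (by positivity)]
  refine ENNReal.ofReal_le_ofReal ?_
  simp only [ENNReal.toReal_ofNat, Real.rpow_two, ← one_div, ← Real.sqrt_eq_rpow, norm_div, norm_mul,
    norm_norm]
  rw [integral_const_mul] at key
  have k1 : ∫ x, (‖u x‖ / ‖x‖) ^ 2 = ∫ x, normSq (u x) / ‖x‖ ^ 2 := by
    simp only [normSq_eq_norm_sq, div_pow]
  have k2 : ∫ x, (‖x‖ * ‖g x‖) ^ 2 = ∫ x, ‖x‖ ^ 2 * normSq (g x) := by
    simp only [normSq_eq_norm_sq, mul_pow]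
  rw [k1, k2]
  rw [← Real.sqrt_sq (by positivity : 0 ≤ 4 / ((d : ℝ) - 2)), ← Real.sqrt_mul (sq_nonneg _)]
  refine Real.sqrt_le_sqrt ?_
  calc ∫ x, normSq (u x) / ‖x‖ ^ 2 = (4 / ((d : ℝ) - 2)) ^ 2 *
        (((d : ℝ) - 2) ^ 2 / 16 * ∫ x, normSq (u x) / ‖x‖ ^ 2) := by field_simp; norm_num
    _ ≤ _ := mul_le_mul_of_nonneg_left key (by positivity)

/-! ### Extension by density to `|x| g ∈ L²` -/

theorem denseRange_schwartzL2 :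
    DenseRange (schwartzL2 : 𝓢(EuclideanSpace ℝ (Fin d), ℂ) → L2Space d) :=
  SchwartzMap.denseRange_toLpCLM ENNReal.ofNat_ne_top

theorem schwartzL2_mem_invNormDomain (hd : 3 ≤ d) (f : 𝓢(EuclideanSpace ℝ (Fin d), ℂ)) :
    schwartzL2 f ∈ invNormDomain d := by
  change MemLp (fun x : EuclideanSpace ℝ (Fin d) => ‖x‖⁻¹ • schwartzL2 f x) 2 volume
  refine (memLp_norm_div hd f).of_le (g := fun x => ‖f x‖ / ‖x‖) ?_ ?_
  · exact measurable_norm.inv.aestronglyMeasurable.smul (Lp.aestronglyMeasurable _)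
  · filter_upwards [coeFn_schwartzL2 f] with x hx
    rw [hx, norm_smul, norm_inv, norm_div, norm_norm, norm_norm, div_eq_inv_mul]

/-- Simultaneous approximation of `g` and `|x| g` by Schwartz functions. -/
theorem exists_schwartz_approx {f g : L2Space d}
    (hfg : ∀ᵐ x : EuclideanSpace ℝ (Fin d), f x = ‖x‖ • g x) {ε : ℝ} (hε : 0 < ε) :
    ∃ φ : 𝓢(EuclideanSpace ℝ (Fin d), ℂ), ‖schwartzL2 φ - g‖ ≤ ε ∧
      eLpNorm (fun x => ‖x‖ • φ x) 2 volume ≤ ‖f‖ₑ + ENNReal.ofReal ε := by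
  -- The function `w g` is in `L²` because `w ≤ 1 + |x|`. A Schwartz approximation `ψ` of `w g` is
  -- divided by the smooth weight `w`; since `v = 1/w` satisfies `v ≤ 1` and `|x| v ≤ 1`, both
  -- errors are at most that of `ψ`.
  set w : EuclideanSpace ℝ (Fin d) → ℝ := fun x => (1 + ‖x‖ ^ 2) ^ (1 / 2 : ℝ) with hw
  set v : EuclideanSpace ℝ (Fin d) → ℝ := fun x => (1 + ‖x‖ ^ 2) ^ (-(1 / 2) : ℝ) with hv
  have hvt : v.HasTemperateGrowth := by fun_prop
  have hwc : Continuous w :=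
    (Function.hasTemperateGrowth_one_add_norm_sq_rpow (EuclideanSpace ℝ (Fin d)) (1 / 2)).1.continuous
  have h1 : ∀ x : EuclideanSpace ℝ (Fin d), 0 < 1 + ‖x‖ ^ 2 := fun x => by positivity
  have hwv : ∀ x, v x * w x = 1 := fun x => by
    simp only [hv, hw]
    rw [← Real.rpow_add (h1 x)]
    norm_num
  have hv0 : ∀ x, 0 < v x := fun x => Real.rpow_pos_of_pos (h1 x) _
  have hw0 : ∀ x, 0 < w x := fun x => Real.rpow_pos_of_pos (h1 x) _
  have hw1 : ∀ x, w x ≤ 1 + ‖x‖ := fun x => by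
    simp only [hw]
    rw [← Real.sqrt_eq_rpow]
    exact Real.sqrt_le_iff.2 ⟨by positivity, by nlinarith [norm_nonneg x]⟩
  have hv1 : ∀ x, v x ≤ 1 := fun x =>
    Real.rpow_le_one_of_one_le_of_nonpos (by nlinarith [sq_nonneg ‖x‖]) (by norm_num)
  have hxv : ∀ x, ‖x‖ * v x ≤ 1 := fun x => by
    have : ‖x‖ ≤ w x := by
      simp only [hw]
      rw [← Real.sqrt_eq_rpow]
      exact Real.le_sqrt_of_sq_le (by linarith)
    calc ‖x‖ * v x ≤ w x * v x := mul_le_mul_of_nonneg_right this (hv0 x).le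
      _ = 1 := by rw [mul_comm, hwv]
  have hh : MemLp (fun x => w x • g x) 2 volume := by
    refine ((Lp.memLp g).norm.add (Lp.memLp f).norm).of_le
      (hwc.aestronglyMeasurable.smul (Lp.aestronglyMeasurable g)) ?_
    filter_upwards [hfg] with x hx
    rw [norm_smul, Real.norm_of_nonneg (hw0 x).le, Pi.add_apply, hx, norm_smul, norm_norm,
      Real.norm_of_nonneg (by positivity)]
    nlinarith [hw1 x, norm_nonneg (g x)]
  obtain ⟨ψ, hψ⟩ := denseRange_schwartzL2.exists_dist_lt hh.toLp hε
  rw [dist_comm, dist_eq_norm] at hψ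
  have hpt : ∀ᵐ x : EuclideanSpace ℝ (Fin d),
      (schwartzL2 ψ - hh.toLp) x = ψ x - w x • g x := by
    filter_upwards [Lp.coeFn_sub (schwartzL2 ψ) hh.toLp, coeFn_schwartzL2 ψ, hh.coeFn_toLp]
      with x a b c
    rw [a, Pi.sub_apply, b, c]
  set φ := SchwartzMap.smulLeftCLM ℂ v ψ
  have hφv : ∀ x, φ x = v x • ψ x := fun x => SchwartzMap.smulLeftCLM_apply_apply hvt ψ x
  have hdiff : ∀ x, φ x - g x = v x • (ψ x - w x • g x) := fun x => by
    rw [hφv, smul_sub, smul_smul, hwv, one_smul]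
  refine ⟨φ, ?_, ?_⟩
  · refine (Lp.norm_le_norm_of_ae_le ?_).trans hψ.le
    filter_upwards [hpt, Lp.coeFn_sub (schwartzL2 φ) g, coeFn_schwartzL2 φ] with x a b c
    rw [a, b, Pi.sub_apply, c, hdiff, norm_smul, Real.norm_of_nonneg (hv0 x).le]
    exact mul_le_of_le_one_left (norm_nonneg _) (hv1 x)
  · have e : ∀ᵐ x : EuclideanSpace ℝ (Fin d),
        ‖‖x‖ • φ x‖ ≤ ‖(f + (fun x => (‖x‖ * v x) • (schwartzL2 ψ - hh.toLp) x) :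
          EuclideanSpace ℝ (Fin d) → ℂ) x‖ := by
      filter_upwards [hpt, hfg] with x a b
      rw [Pi.add_apply, a, b, mul_smul, ← hdiff, ← smul_add, add_sub_cancel]
    have hm : AEStronglyMeasurable
        (fun x => (‖x‖ * v x) • (schwartzL2 ψ - hh.toLp : L2Space d) x) volume :=
      (continuous_norm.mul hvt.1.continuous).aestronglyMeasurable.smul (Lp.aestronglyMeasurable _)
    refine (eLpNorm_mono_ae e).trans ((eLpNorm_add_le (Lp.aestronglyMeasurable f) hm
      one_le_two).trans (add_le_add (Lp.enorm_def f).ge ?_))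
    calc eLpNorm (fun x => (‖x‖ * v x) • (schwartzL2 ψ - hh.toLp : L2Space d) x) 2 volume
        ≤ eLpNorm (schwartzL2 ψ - hh.toLp : L2Space d) 2 volume := by
          refine eLpNorm_mono_ae (Eventually.of_forall fun x => ?_)
          rw [norm_smul, Real.norm_of_nonneg (mul_nonneg (norm_nonneg _) (hv0 x).le)]
          exact mul_le_of_le_one_left (norm_nonneg _) (hxv x)
      _ = ‖schwartzL2 ψ - hh.toLp‖ₑ := (Lp.enorm_def _).symm
      _ ≤ ENNReal.ofReal ε := by
          rw [← ofReal_norm]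
          exact ENNReal.ofReal_le_ofReal hψ.le

/-- The weighted resolvent estimate for data in the domain of `|x|⁻¹`. -/
theorem eLpNorm_resolvent_le (hd : 3 ≤ d) {z : ℂ} (hz : z ∉ ofReal '' Set.Ici (0 : ℝ))
    {f g w : L2Space d} (hfg : ∀ᵐ x : EuclideanSpace ℝ (Fin d), f x = ‖x‖ • g x)
    (hw : (w : 𝓢'(EuclideanSpace ℝ (Fin d), ℂ)) =
      fourierMultiplierCLM ℂ (fun ξ => (symbol d z ξ)⁻¹) g) :
    eLpNorm (fun x => ‖x‖⁻¹ • w x) 2 volume ≤ ENNReal.ofReal (4 / ((d : ℝ) - 2)) * ‖f‖ₑ := by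
  have hm := hasTemperateGrowth_inv_symbol (d := d) hz
  obtain ⟨K, hK⟩ := exists_sobolevTwo_resolvent (d := d) hz
  choose φ hφ1 hφ2 using fun n : ℕ => exists_schwartz_approx hfg
    (Nat.one_div_pos_of_nat (α := ℝ) (n := n))
  set u := fun n => SchwartzMap.fourierMultiplierCLM ℂ (fun ξ => (symbol d z ξ)⁻¹) (φ n)
  have hε : Tendsto (fun n : ℕ => 1 / ((n : ℝ) + 1)) atTop (𝓝 0) :=
    tendsto_one_div_add_atTop_nhds_zero_nat
  -- Here the `z`-dependent bound `K` serves only to obtain convergence.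
  have hu : ∀ n, ‖schwartzL2 (u n) - w‖ ≤ |K| * (1 / ((n : ℝ) + 1)) := by
    intro n
    obtain ⟨q, -, hq, hqK⟩ := hK (schwartzL2 (φ n) - g)
    have : schwartzL2 (u n) - w = q := by
      apply L2Space.ext_distribution
      rw [hq, ← Lp.toTemperedDistributionCLM_apply, ← Lp.toTemperedDistributionCLM_apply, map_sub,
        map_sub, map_sub, Lp.toTemperedDistributionCLM_apply, Lp.toTemperedDistributionCLM_apply,
        Lp.toTemperedDistributionCLM_apply, Lp.toTemperedDistributionCLM_apply, hw,
        schwartzL2_toTemperedDistribution, schwartzL2_toTemperedDistribution,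
        fourierMultiplierCLM_toTemperedDistributionCLM_eq hm]
    rw [this]
    exact hqK.trans (mul_le_mul (le_abs_self K) (hφ1 n) (norm_nonneg _) (abs_nonneg K))
  have hlim : Tendsto (fun n => schwartzL2 (u n)) atTop (𝓝 w) := by
    rw [tendsto_iff_norm_sub_tendsto_zero]
    refine squeeze_zero (fun n => norm_nonneg _) hu ?_
    simpa using hε.const_mul |K|
  obtain ⟨ns, hns, hae⟩ := (tendstoInMeasure_of_tendsto_Lp hlim).exists_seq_tendsto_ae
  have hae' : ∀ᵐ x : EuclideanSpace ℝ (Fin d),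
      Tendsto (fun n => ‖x‖⁻¹ • u (ns n) x) atTop (𝓝 (‖x‖⁻¹ • w x)) := by
    filter_upwards [hae, ae_all_iff.2 fun n => coeFn_schwartzL2 (u (ns n))] with x hx hx2
    simp only [hx2] at hx
    exact hx.const_smul _
  have hmeas : ∀ n, AEStronglyMeasurable (fun x => ‖x‖⁻¹ • u (ns n) x) volume := fun n =>
    measurable_norm.inv.aestronglyMeasurable.smul (u (ns n)).continuous.aestronglyMeasurable
  -- Multiplication by `|x|⁻¹` is not continuous on `L²`, so the weighted norm passes to the limit
  -- by Fatou's lemma along an a.e. convergent subsequence.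
  refine (Lp.eLpNorm_lim_le_liminf_eLpNorm hmeas _ hae').trans ?_
  have hb : ∀ n, eLpNorm (fun x => ‖x‖⁻¹ • u (ns n) x) 2 volume ≤
      ENNReal.ofReal (4 / ((d : ℝ) - 2)) * (‖f‖ₑ + ENNReal.ofReal (1 / ((ns n : ℝ) + 1))) := fun n =>
    (eLpNorm_resolvent_schwartz_le hd hz (φ (ns n))).trans (mul_le_mul_right (hφ2 (ns n)) _)
  have hlim2 : Tendsto (fun n => ENNReal.ofReal (4 / ((d : ℝ) - 2)) *
      (‖f‖ₑ + ENNReal.ofReal (1 / ((ns n : ℝ) + 1)))) atTop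
      (𝓝 (ENNReal.ofReal (4 / ((d : ℝ) - 2)) * (‖f‖ₑ + ENNReal.ofReal 0))) := by
    refine ENNReal.Tendsto.const_mul (tendsto_const_nhds.add (ENNReal.tendsto_ofReal
      (hε.comp hns.tendsto_atTop))) (Or.inr ENNReal.ofReal_ne_top)
  rw [ENNReal.ofReal_zero, add_zero] at hlim2
  exact (liminf_le_liminf (Eventually.of_forall hb)).trans_eq hlim2.liminf_eq

/-! ### The weighted resolvent as an unbounded operator -/

theorem resolvent_apply_toTemperedDistribution {z : ℂ} (hz : z ∉ ofReal '' Set.Ici (0 : ℝ))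
    (g : (UnboundedOperator.resolvent (freeHamiltonian d) z).domain) :
    ((UnboundedOperator.resolvent (freeHamiltonian d) z g : L2Space d) :
      𝓢'(EuclideanSpace ℝ (Fin d), ℂ)) =
      fourierMultiplierCLM ℂ (fun ξ => (symbol d z ξ)⁻¹) (g : L2Space d) := by
  obtain ⟨ψ, hψ⟩ := (bijective_shift hz).2 (g : L2Space d)
  have h := LinearPMap.inverse_apply_eq (f := UnboundedOperator.shift (freeHamiltonian d) z)
    (LinearMap.ker_eq_bot.2 (bijective_shift hz).1) (y := g) (x := ψ) hψ
  have h' : UnboundedOperator.resolvent (freeHamiltonian d) z g = (ψ : L2Space d) := h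
  rw [h']
  exact (shift_eq_iff hz _ ψ).1 hψ

theorem mem_resolvent_domain {z : ℂ} (hz : z ∉ ofReal '' Set.Ici (0 : ℝ)) (g : L2Space d) :
    g ∈ (UnboundedOperator.resolvent (freeHamiltonian d) z).domain := by
  rw [UnboundedOperator.resolvent, LinearPMap.inverse_domain]
  exact (bijective_shift hz).2 g

theorem ae_eq_norm_smul_invNormMul (hd : 0 < d) (ψ : (invNormMul d).domain) :
    ∀ᵐ x : EuclideanSpace ℝ (Fin d), (ψ : L2Space d) x = ‖x‖ • invNormMul d ψ x := by
  have : Nonempty (Fin d) := ⟨⟨0, hd⟩⟩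
  have hne : ∀ᵐ x : EuclideanSpace ℝ (Fin d), x ≠ 0 := by
    rw [ae_iff]; simp
  filter_upwards [invNormMul_apply ψ, hne] with x hx h0
  rw [hx, smul_smul, mul_inv_cancel₀ (norm_ne_zero_iff.2 h0), one_smul]

theorem eLpNorm_resolvent_invNormMul_le (hd : 3 ≤ d) {z : ℂ} (hz : z ∉ ofReal '' Set.Ici (0 : ℝ))
    (ψ : (invNormMul d).domain) :
    eLpNorm (fun x : EuclideanSpace ℝ (Fin d) => ‖x‖⁻¹ •
      UnboundedOperator.resolvent (freeHamiltonian d) z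
        ⟨invNormMul d ψ, mem_resolvent_domain hz _⟩ x) 2 volume ≤
      ENNReal.ofReal (4 / ((d : ℝ) - 2)) * ‖(ψ : L2Space d)‖ₑ :=
  eLpNorm_resolvent_le hd hz (ae_eq_norm_smul_invNormMul (by omega) ψ)
    (resolvent_apply_toTemperedDistribution hz _)

/-- The estimate itself shows that the outer factor `|x|⁻¹` can be applied, so only the inner one
restricts the domain. Density then follows, because that domain contains the Schwartz functions. -/
theorem invNormDomain_le_weightedResolvent_domain (hd : 3 ≤ d) {z : ℂ}
    (hz : z ∉ ofReal '' Set.Ici (0 : ℝ)) {ψ : L2Space d} (hψ : ψ ∈ invNormDomain d) :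
    ψ ∈ (weightedResolvent d z).domain := by
  refine (UnboundedOperator.mem_prod_domain _ _ _).2
    ⟨(UnboundedOperator.mem_prod_domain _ _ _).2 ⟨hψ, mem_resolvent_domain hz _⟩, ?_⟩
  refine ⟨measurable_norm.inv.aestronglyMeasurable.smul (Lp.aestronglyMeasurable _), ?_⟩
  exact (eLpNorm_resolvent_invNormMul_le hd hz ⟨ψ, hψ⟩).trans_lt
    (ENNReal.mul_lt_top ENNReal.ofReal_lt_top enorm_lt_top)

theorem dense_weightedResolvent_domain (hd : 3 ≤ d) {z : ℂ}
    (hz : z ∉ ofReal '' Set.Ici (0 : ℝ)) : Dense ((weightedResolvent d z).domain : Set (L2Space d)) := by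
  refine denseRange_schwartzL2.mono ?_
  rintro _ ⟨f, rfl⟩
  exact invNormDomain_le_weightedResolvent_domain hd hz (schwartzL2_mem_invNormDomain hd f)

theorem opENorm_weightedResolvent_le (hd : 3 ≤ d) {z : ℂ} (hz : z ∉ ofReal '' Set.Ici (0 : ℝ)) :
    UnboundedOperator.opENorm (weightedResolvent d z) ≤ ENNReal.ofReal (4 / ((d : ℝ) - 2)) := by
  refine iSup_le fun ⟨ψ, hψ⟩ => ENNReal.div_le_of_le_mul ?_
  obtain ⟨h1, h2⟩ := (UnboundedOperator.mem_prod_domain _ _ _).1 hψ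
  obtain ⟨h3, h4⟩ := (UnboundedOperator.mem_prod_domain _ _ _).1 h1
  have e : weightedResolvent d z ⟨ψ, hψ⟩ = invNormMul d ⟨_, h2⟩ := rfl
  rw [e, Lp.enorm_def, eLpNorm_congr_ae (invNormMul_apply _)]
  exact eLpNorm_resolvent_invNormMul_le hd hz ⟨ψ, h3⟩

/-- The square root in `C₃(d)` is at least `1` because of the summand `1`, and `4 ≤ 6`. -/
theorem le_uniformConstant (hd : 3 ≤ d) : 4 / ((d : ℝ) - 2) ≤ uniformConstant d := by
  have hd2 : (0 : ℝ) < (d : ℝ) - 2 := by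
    have : (3 : ℝ) ≤ d := by exact_mod_cast hd
    linarith
  rw [uniformConstant]
  have h1 : 1 ≤ √((((d : ℝ) - 1) / ((d : ℝ) - 2)) ^ 2 +
      3 / 4 * (2 / ((d : ℝ) - 2)) ^ (2 / 3 : ℝ) + 1) := by
    rw [Real.one_le_sqrt]
    have : 0 ≤ (2 / ((d : ℝ) - 2)) ^ (2 / 3 : ℝ) := by positivity
    nlinarith [sq_nonneg (((d : ℝ) - 1) / ((d : ℝ) - 2))]
  calc 4 / ((d : ℝ) - 2) ≤ 6 / ((d : ℝ) - 2) * 1 := by rw [mul_one]; gcongr; norm_num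
    _ ≤ _ := by gcongr

end UniformResolvent

end

theorem mainTheorem1 (d : ℕ) (hd : 3 ≤ d) :
    UnboundedOperator.spectrum (freeHamiltonian d) = Complex.ofReal '' Set.Ici (0 : ℝ) ∧
    (∀ z ∉ UnboundedOperator.spectrum (freeHamiltonian d),
      Dense ((weightedResolvent d z).domain : Set (L2Space d))) ∧
    (⨆ z ∈ (UnboundedOperator.spectrum (freeHamiltonian d))ᶜ,
      UnboundedOperator.opENorm (weightedResolvent d z)) < ⊤ ∧
    (⨆ z ∈ (UnboundedOperator.spectrum (freeHamiltonian d))ᶜ,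
      UnboundedOperator.opENorm (weightedResolvent d z)) ≤
        ENNReal.ofReal (uniformConstant d) := by
  have hs := UniformResolvent.spectrum_freeHamiltonian (d := d) (by omega)
  have hle : (⨆ z ∈ (UnboundedOperator.spectrum (freeHamiltonian d))ᶜ,
      UnboundedOperator.opENorm (weightedResolvent d z)) ≤ ENNReal.ofReal (uniformConstant d) := by
    refine iSup₂_le fun z hz => ?_
    rw [hs] at hz
    exact (UniformResolvent.opENorm_weightedResolvent_le hd hz).trans
      (ENNReal.ofReal_le_ofReal (UniformResolvent.le_uniformConstant hd))
  refine ⟨hs, fun z hz => ?_, hle.trans_lt ENNReal.ofReal_lt_top, hle⟩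
  rw [hs] at hz
  exact UniformResolvent.dense_weightedResolvent_domain hd hz
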